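/- Let $n\ge 2$ and let $\mathbb{R}^{n,1}=\mathbb{R}^n\times\mathbb{R}$ be the Minkowski space with scalar product $\langle X,Y\rangle=X'\cdot Y'-X_{n+1}Y_{n+1}$. Let $\mathbb{H}=\{x\in\mathbb{R}^{n,1} : \langle x,x\rangle=-1,\ x_{n+1}>0\}$ be the future unit hyperboloid, fix a point $o\in\mathbb{H}$, and let $r(x)=\operatorname{arcosh}(-\langle o,x\rangle)$ be the hyperbolic distance from $o$ to $x$. A function on $\mathbb{H}$ is called radial if it is a function of $r(x)$ only. The radial graph of $\varphi:\mathbb{H}\to\mathbb{R}$ is the hypersurface $\{e^{\varphi(x)}x : x\in\mathbb{H}\}$. If it is spacelike (its induced metric is Riemannian), with future oriented unit normal field $N$, its principal curvatures $\kappa=(\kappa_1,\dots,\kappa_n)$ at a point are the eigenvalues of $dN$, and $H_m=\sigma_m(\kappa)$ denotes their $m$-th elementary symmetric function. The function $\varphi$ is called admissible if its radial graph is spacelike and $\sigma_1(\kappa)>0$, $\sigma_2(\kappa)>0$ at every point of the graph. Set $$F_2(\varphi)(x)=e^{\varphi(x)}\left[\binom{n}{2}^{-1}H_2(X)\right]^{1/2},\qquad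 X=e^{\varphi(x)}x .$$ Here a function is of class $C^{k,\alpha}$ if it is $C^k$ and its $k$-th derivatives are $\alpha$-Hölder continuous on every compact set; for functions on $\mathbb{H}$ this is read in the global chart $x=(x',x_{n+1})\mapsto x'\in\mathbb{R}^n$. **Theorem.** Let $\alpha\in(0,1)$, let $h:[0,+\infty)\to\mathbb{R}$ be a positive function of class $C^{2,\alpha}$ which is constant on some neighborhood of $0$, and let $\varphi_0$ be a real number. Then there is exactly one admissible radial function $\varphi:\mathbb{H}\to\mathbb{R}$ of class $C^{4,\alpha}$ such that $$F_2(\varphi)(x)=h(r(x))\ \text{ for all } x\in\mathbb{H},\qquad \varphi(o)=\varphi_0 .$$ -/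

import Mathlib

open scoped NNReal

noncomputable section

namespace RadialGraph

/-- The Minkowski space `ℝ^{n,1} = ℝⁿ × ℝ`, with points `X = (X', X_{n+1})`. -/
abbrev Minkowski (n : ℕ) : Type := EuclideanSpace ℝ (Fin n) × ℝ

/-- The Lorentzian scalar product `⟨X, Y⟩ = X' · Y' - X_{n+1} Y_{n+1}`. -/
def lorentz {n : ℕ} (X Y : Minkowski n) : ℝ := inner ℝ X.1 Y.1 - X.2 * Y.2

/-- The future unit hyperboloid `ℍ`, the model of the `n`-dimensional hyperbolic space. -/
def hyperboloid (n : ℕ) : Set (Minkowski n) := {x | lorentz x x = -1 ∧ 0 < x.2}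

theorem lift_mem_hyperboloid {n : ℕ} (y : EuclideanSpace ℝ (Fin n)) :
    ((y, √(1 + ‖y‖ ^ 2)) : Minkowski n) ∈ hyperboloid n := by
  have h : (0 : ℝ) < 1 + ‖y‖ ^ 2 := by positivity
  refine ⟨?_, Real.sqrt_pos.2 h⟩
  simp only [lorentz, real_inner_self_eq_norm_sq, Real.mul_self_sqrt h.le]
  ring

/-- The point `x = (x', √(1 + |x'|²))` of `ℍ` above `x' ∈ ℝⁿ`. This is the inverse of the global
chart `x ↦ x'` of `ℍ`. -/
def lift {n : ℕ} (y : EuclideanSpace ℝ (Fin n)) : hyperboloid n :=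
  ⟨(y, √(1 + ‖y‖ ^ 2)), lift_mem_hyperboloid y⟩

/-- The hyperbolic distance on `ℍ`, given by `cosh d(x, y) = -⟨x, y⟩`. -/
def hypDist {n : ℕ} (x y : hyperboloid n) : ℝ := Real.arcosh (-lorentz x.1 y.1)

/-- `φ : ℍ → ℝ` is radial about `o` if it factors through `r(x) = d(o, x)`. -/
def IsRadial {n : ℕ} (o : hyperboloid n) (φ : hyperboloid n → ℝ) : Prop :=
  ∃ f : ℝ → ℝ, ∀ x, φ x = f (hypDist o x)

/-- `f` is of class `C^{k,α}` on `s`: it is `C^k` on `s` and its `k`-th derivative is `α`-Hölder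
on every compact subset of `s`. -/
def HolderClassOn {E : Type*} [NormedAddCommGroup E] [NormedSpace ℝ E]
    (k : ℕ) (α : ℝ≥0) (f : E → ℝ) (s : Set E) : Prop :=
  ContDiffOn ℝ k f s ∧
    ∀ K ⊆ s, IsCompact K → ∃ C : ℝ≥0, HolderOnWith C α (iteratedFDerivWithin ℝ k f s) K

/-- `φ : ℍ → ℝ` is of class `C^{k,α}`: it is so when read in the global chart `x ↦ x'`. -/
def HolderClass {n : ℕ} (k : ℕ) (α : ℝ≥0) (φ : hyperboloid n → ℝ) : Prop :=
  HolderClassOn k α (fun y : EuclideanSpace ℝ (Fin n) => φ (lift y)) Set.univ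

/-- The parametrization `x' ↦ e^{φ(x)} x`, with `x = lift x'`, of the radial graph
`{e^{φ(x)} x | x ∈ ℍ}` of `φ`. -/
def graphParam {n : ℕ} (φ : hyperboloid n → ℝ) (y : EuclideanSpace ℝ (Fin n)) : Minkowski n :=
  Real.exp (φ (lift y)) • (lift y : Minkowski n)

/-- A parametrized hypersurface is spacelike if the metric induced on it is Riemannian. -/
def IsSpacelike {n : ℕ} (F : EuclideanSpace ℝ (Fin n) → Minkowski n) : Prop :=
  Differentiable ℝ F ∧ ∀ y v, v ≠ 0 → 0 < lorentz (fderiv ℝ F y v) (fderiv ℝ F y v)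

/-- `N` is a future oriented unit vector orthogonal to the hypersurface `F` at `F y`. -/
def IsFutureUnitNormal {n : ℕ} (F : EuclideanSpace ℝ (Fin n) → Minkowski n)
    (y : EuclideanSpace ℝ (Fin n)) (N : Minkowski n) : Prop :=
  lorentz N N = -1 ∧ 0 < N.2 ∧ ∀ v, lorentz N (fderiv ℝ F y v) = 0

/-- The future oriented unit normal field of the hypersurface `F`; it exists and is unique when
`F` is spacelike. -/
def unitNormal {n : ℕ} (F : EuclideanSpace ℝ (Fin n) → Minkowski n)
    (y : EuclideanSpace ℝ (Fin n)) : Minkowski n :=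
  Classical.epsilon (IsFutureUnitNormal F y)

/-- The curvature endomorphism `dN` of the hypersurface `F` at `F y`, transported to the parameter
space by `dF`: the endomorphism `S` of `ℝⁿ` with `dF (S v) = dN v` for all `v`. It exists and is
unique when `F` is spacelike and of class `C²`. -/
def curvatureEnd {n : ℕ} (F : EuclideanSpace ℝ (Fin n) → Minkowski n)
    (y : EuclideanSpace ℝ (Fin n)) : Module.End ℝ (EuclideanSpace ℝ (Fin n)) :=
  Classical.epsilon fun S => ∀ v, fderiv ℝ F y (S v) = fderiv ℝ (unitNormal F) y v

/-- The principal curvatures: the eigenvalues of the curvature endomorphism, with multiplicity. -/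
def principalCurvatures {n : ℕ} (F : EuclideanSpace ℝ (Fin n) → Minkowski n)
    (y : EuclideanSpace ℝ (Fin n)) : Multiset ℝ :=
  (LinearMap.charpoly (curvatureEnd F y)).roots

/-- The `m`-th mean curvature `H_m = σ_m(κ₁, …, κₙ)`. -/
def meanCurvature {n : ℕ} (m : ℕ) (F : EuclideanSpace ℝ (Fin n) → Minkowski n)
    (y : EuclideanSpace ℝ (Fin n)) : ℝ :=
  (principalCurvatures F y).esymm m

/-- `φ` is `m`-admissible: its radial graph is spacelike and the principal curvatures of the graph
lie everywhere in the cone `Γ_m = {κ | σ_i(κ) > 0 for i = 1, …, m}`. -/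
def IsAdmissible {n : ℕ} (m : ℕ) (φ : hyperboloid n → ℝ) : Prop :=
  IsSpacelike (graphParam φ) ∧
    ∀ y, ∀ i ∈ Finset.Icc 1 m, 0 < meanCurvature i (graphParam φ) y

/-- The radial operator `F_m(φ)(x) = e^{φ(x)} [H_m(X) / (n choose m)]^{1/m}`, where
`X = e^{φ(x)} x`. The first component of `x` is its coordinate in the global chart. -/
def radialOp {n : ℕ} (m : ℕ) (φ : hyperboloid n → ℝ) (x : hyperboloid n) : ℝ :=
  Real.exp (φ x) *
    (meanCurvature m (graphParam φ) x.1.1 / (n.choose m : ℝ)) ^ (1 / (m : ℝ))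

end RadialGraph

end

/-!
In the variable `c = cosh r = -⟨o, x⟩` a radial function is `φ(x) = P(c)`; let `p = P'` be its
slope. The function `c` on the hyperboloid satisfies `|∇c|² = c² - 1` and `Hess c = c · g`, so the
curvature endomorphism of the graph is a scalar plus an endomorphism of rank one along `∇c`
(`RadialGraph.curvatureEnd_graphParam`). The principal curvatures are therefore `e^{-φ} a`, once,
and `e^{-φ} b`, with multiplicity `n - 1`, for explicit functions `a` of `c`, `p`, `p'` and `b` of
`c`, `p` (`RadialGraph.principalCurvatures_graphParam`). In particular `e^φ` drops out of
`F₂(φ)² = ((n - 2) b² + 2 a b) / n`, and `F₂(φ) = h` is an equation of first order for `p` alone,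

  `(c² - 1) p' = (n/2) w (h² w / (1 + p c) - (1 + p c)) - c p³ (c² - 1)`,
  `w = 1 - p² (c² - 1)`,

where the graph is spacelike exactly if `w > 0`, and `σ₁, σ₂ > 0` forces `1 + p c > 0`. The value
`φ(o) = P(1)` is the constant of integration.

*The pole.* The equation is singular at `c = 1`. A solution with bounded derivative must have
`p(1) = h(0) - 1`, and there the right-hand side has derivative `-n` in `p`. Since `h` is constant
near `0`, the equation has, near `c = 1`, analytic coefficients and is of Briot–Bouquet type. Its
formal exponent `-n / 2` is negative, so there is a holomorphic solution with the required value
(`BriotBouquet.exists_solution`, by contraction against the explicit inverse of the Euler operator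
`z d/dz + n/2`). It is smooth across `c = 1`, and this makes `φ` smooth at `o`, because `c` is
a smooth function on the hyperboloid.

*Existence for all `c`.* Beyond the pole the solution is kept in the admissible region by two
barriers: the slope `1 / √(c² - 1)` of the light cone, which solves the equation, and `-(1 - m) / c`
with `m` small (`SlopeODE.exists_extension`).

*Regularity.* For `c > 1` the slope gains one derivative over `h`, and `P` gains another
(`SlopeODE.IsSol.ckHolderAt`, `SlopeODE.exists_profile`).

*Uniqueness.* An admissible radial solution is even along a geodesic through `o`, so `p` has
a limit at the pole. The equation in the limit is `(1 + p(1))² = h(0)²`, and `1 + p(1) ≥ 0` selects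
`p(1) = h(0) - 1` (`RadialGraph.exists_profile_of_solution`). Near the pole the right-hand side
decreases in `p`, so the distance of two solutions decreases in `c`; as it tends to `0` at the pole,
they agree near it, and everywhere by uniqueness for regular equations (`SlopeODE.IsSol.eqOn`).
-/

noncomputable section

/-! ### Local Hölder classes -/

namespace HolderGerm

open Filter Topology Asymptotics Set

/-- `f` is `α`-Hölder on some neighbourhood of `x`. The condition is phrased through the filter
`𝓝 (x, x)`, so that the calculus of `=O` applies to differences. -/
def LocHolderAt {E F : Type} [NormedAddCommGroup E] [NormedAddCommGroup F]
    (α : ℝ) (f : E → F) (x : E) : Prop :=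
  (fun q : E × E => f q.1 - f q.2) =O[𝓝 (x, x)] fun q => ‖q.1 - q.2‖ ^ α

/-- `f` is of class `C^{k,α}` on some neighbourhood of `x`. -/
def CkHolderAt {E F : Type} [NormedAddCommGroup E] [NormedSpace ℝ E] [NormedAddCommGroup F]
    [NormedSpace ℝ F] (k : ℕ) (α : ℝ) (f : E → F) (x : E) : Prop :=
  ContDiffAt ℝ k f x ∧ LocHolderAt α (iteratedFDeriv ℝ k f) x

section

variable {E F G H : Type} [NormedAddCommGroup E] [NormedAddCommGroup F] [NormedAddCommGroup G]
  [NormedAddCommGroup H] {α : ℝ} {k : ℕ} {x : E}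

theorem LocHolderAt.congr {f g : E → F} (hf : LocHolderAt α f x) (h : f =ᶠ[𝓝 x] g) :
    LocHolderAt α g x := by
  refine IsBigO.congr' hf ?_ EventuallyEq.rfl
  have h1 : ∀ᶠ q : E × E in 𝓝 (x, x), f q.1 = g q.1 :=
    (continuous_fst.tendsto (x, x)).eventually h
  have h2 : ∀ᶠ q : E × E in 𝓝 (x, x), f q.2 = g q.2 :=
    (continuous_snd.tendsto (x, x)).eventually h
  filter_upwards [h1, h2] with q a b
  rw [a, b]

theorem LocHolderAt.continuousAt {f : E → F} (hα : 0 < α) (hf : LocHolderAt α f x) :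
    ContinuousAt f x := by
  have h1 : Tendsto (fun y : E => (y, x)) (𝓝 x) (𝓝 (x, x)) :=
    Continuous.tendsto (by fun_prop) x
  have h2 : Tendsto (fun y : E => ‖y - x‖ ^ α) (𝓝 x) (𝓝 0) := by
    have : Continuous fun y : E => ‖y - x‖ ^ α :=
      (by fun_prop : Continuous fun y : E => ‖y - x‖).rpow_const fun _ => Or.inr hα.le
    simpa [Real.zero_rpow hα.ne'] using this.tendsto x
  have h3 := (hf.comp_tendsto h1).trans_tendsto h2
  exact tendsto_sub_nhds_zero_iff.1 h3

theorem LocHolderAt.eventually {f : E → F} (hf : LocHolderAt α f x) :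
    ∀ᶠ y in 𝓝 x, LocHolderAt α f y := by
  obtain ⟨C, hC⟩ := hf.bound
  have h1 : Tendsto (fun y : E => (y, y)) (𝓝 x) (𝓝 (x, x)) :=
    Continuous.tendsto (by fun_prop) x
  filter_upwards [h1.eventually (eventually_eventually_nhds.2 hC)] with y hy
  exact IsBigO.of_bound C hy

theorem LocHolderAt.of_norm_sub_le {f : E → F} {g : E → G} (hf : LocHolderAt α f x)
    (h : ∀ y z, ‖g y - g z‖ ≤ ‖f y - f z‖) : LocHolderAt α g x :=
  (IsBigO.of_bound 1 (Eventually.of_forall fun q => by simpa using h q.1 q.2)).trans hf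

theorem isBigO_sub_rpow (hα1 : α ≤ 1) :
    (fun q : E × E => q.1 - q.2) =O[𝓝 (x, x)] fun q => ‖q.1 - q.2‖ ^ α := by
  have h1 : ∀ᶠ q : E × E in 𝓝 (x, x), ‖q.1 - q.2‖ < 1 := by
    have : ContinuousAt (fun q : E × E => ‖q.1 - q.2‖) (x, x) := by fun_prop
    exact this.eventually_lt_const (by simp)
  refine IsBigO.of_bound 1 ?_
  filter_upwards [h1] with q hq
  rw [one_mul, Real.norm_of_nonneg (by positivity)]
  rcases (norm_nonneg (q.1 - q.2)).eq_or_lt with h0 | h0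
  · rw [← h0]; positivity
  · exact Real.self_le_rpow_of_le_one h0.le hq.le hα1

theorem LocHolderAt.bilinear [NormedSpace ℝ F] [NormedSpace ℝ G] [NormedSpace ℝ H]
    {f : E → F} {g : E → G} (B : F →L[ℝ] G →L[ℝ] H) (hα : 0 < α)
    (hf : LocHolderAt α f x) (hg : LocHolderAt α g x) :
    LocHolderAt α (fun y => B (f y) (g y)) x := by
  have hfb : (fun q : E × E => f q.2) =O[𝓝 (x, x)] fun _ => (1 : ℝ) :=
    Tendsto.isBigO_one ℝ ((hf.continuousAt hα).tendsto.comp (continuous_snd.tendsto (x, x)))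
  have hgb : (fun q : E × E => g q.1) =O[𝓝 (x, x)] fun _ => (1 : ℝ) :=
    Tendsto.isBigO_one ℝ ((hg.continuousAt hα).tendsto.comp (continuous_fst.tendsto (x, x)))
  have key : ∀ {u : E × E → F} {v : E × E → G} {a b : E × E → ℝ}, u =O[𝓝 (x, x)] a →
      v =O[𝓝 (x, x)] b → (fun q => B (u q) (v q)) =O[𝓝 (x, x)] fun q => a q * b q := by
    intro u v a b hu hv
    refine IsBigO.trans (g := fun q => ‖u q‖ * ‖v q‖) (IsBigO.of_bound ‖B‖ ?_)
      (hu.norm_left.mul hv.norm_left)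
    refine Eventually.of_forall fun q => ?_
    rw [Real.norm_of_nonneg (by positivity), ← mul_assoc]
    exact B.le_opNorm₂ _ _
  have h1 := key hf hgb
  have h2 := key hfb hg
  simp only [mul_one, one_mul] at h1 h2
  refine (h1.add h2).congr_left fun q => ?_
  simp only [map_sub, sub_apply]
  abel

/-- A function that is locally `α`-Hölder at every point of a compact set is `α`-Hölder on it. -/
theorem exists_holderOnWith_of_locHolderAt {α : ℝ≥0} (hα : 0 < α) {f : E → F} {K : Set E}
    (hK : IsCompact K) (hf : ∀ y ∈ K, LocHolderAt α f y) : ∃ C : ℝ≥0, HolderOnWith C α f K := by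
  have hα' : (0 : ℝ) < α := hα
  have hc : ContinuousOn f K := fun y hy => ((hf y hy).continuousAt hα').continuousWithinAt
  have key : ∃ C : ℝ, ∀ q ∈ K ×ˢ K, ‖f q.1 - f q.2‖ ≤ C * ‖q.1 - q.2‖ ^ (α : ℝ) := by
    refine (hK.prod hK).induction_on
      (p := fun s => ∃ C : ℝ, ∀ q ∈ s, ‖f q.1 - f q.2‖ ≤ C * ‖q.1 - q.2‖ ^ (α : ℝ))
      ⟨0, by simp⟩ (fun s t hst ⟨C, hC⟩ => ⟨C, fun q hq => hC q (hst hq)⟩) ?_ ?_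
    · rintro s t ⟨C, hC⟩ ⟨D, hD⟩
      refine ⟨max C D, fun q hq => ?_⟩
      rcases hq with hq | hq
      · exact (hC q hq).trans (by gcongr; exact le_max_left _ _)
      · exact (hD q hq).trans (by gcongr; exact le_max_right _ _)
    · rintro ⟨y, z⟩ ⟨hy, hz⟩
      by_cases hyz : y = z
      · subst hyz
        obtain ⟨C, hC⟩ := (hf y hy).bound
        refine ⟨_, mem_nhdsWithin_of_mem_nhds hC, C, fun q hq => ?_⟩
        have : ‖f q.1 - f q.2‖ ≤ C * ‖‖q.1 - q.2‖ ^ (α : ℝ)‖ := hq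
        rwa [Real.norm_of_nonneg (by positivity)] at this
      · -- Away from the diagonal the quotient is continuous, hence locally bounded.
        have hpos : 0 < ‖y - z‖ ^ (α : ℝ) :=
          Real.rpow_pos_of_pos (norm_pos_iff.2 (sub_ne_zero.2 hyz)) _
        have c1 : ContinuousWithinAt (fun q : E × E => ‖f q.1 - f q.2‖) (K ×ˢ K) (y, z) := by
          have a1 : ContinuousWithinAt (fun q : E × E => f q.1) (K ×ˢ K) (y, z) :=
            (hc y hy).comp continuousWithinAt_fst (fun q hq => hq.1)
          have a2 : ContinuousWithinAt (fun q : E × E => f q.2) (K ×ˢ K) (y, z) :=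
            (hc z hz).comp continuousWithinAt_snd (fun q hq => hq.2)
          exact (a1.sub a2).norm
        have c2 : ContinuousWithinAt (fun q : E × E => ‖q.1 - q.2‖ ^ (α : ℝ)) (K ×ˢ K) (y, z) :=
          ((by fun_prop : Continuous fun q : E × E => ‖q.1 - q.2‖).rpow_const
            fun _ => Or.inr hα'.le).continuousWithinAt
        have c3 := c1.div c2 hpos.ne'
        have h3 : ∀ᶠ q in 𝓝[K ×ˢ K] (y, z), ‖f q.1 - f q.2‖ / ‖q.1 - q.2‖ ^ (α : ℝ) <
            ‖f y - f z‖ / ‖y - z‖ ^ (α : ℝ) + 1 :=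
          c3.eventually_lt_const (lt_add_one _)
        have h4 : ∀ᶠ q in 𝓝[K ×ˢ K] (y, z), 0 < ‖q.1 - q.2‖ ^ (α : ℝ) :=
          c2.eventually_const_lt hpos
        refine ⟨_, h3.and h4, ‖f y - f z‖ / ‖y - z‖ ^ (α : ℝ) + 1, fun q hq => ?_⟩
        have : ‖f q.1 - f q.2‖ / ‖q.1 - q.2‖ ^ (α : ℝ) < _ := hq.1
        exact ((div_lt_iff₀ hq.2).1 this).le
  obtain ⟨C, hC⟩ := key
  refine ⟨C.toNNReal, fun y hy z hz => ?_⟩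
  have h1 := hC (y, z) ⟨hy, hz⟩
  have h2 : ‖f y - f z‖ ≤ C.toNNReal * ‖y - z‖ ^ (α : ℝ) :=
    h1.trans (by gcongr; exact Real.le_coe_toNNReal C)
  rw [edist_dist, edist_dist, dist_eq_norm, dist_eq_norm,
    ENNReal.ofReal_rpow_of_nonneg (norm_nonneg _) hα'.le, ← ENNReal.ofReal_coe_nnreal,
    ← ENNReal.ofReal_mul (by positivity)]
  exact ENNReal.ofReal_le_ofReal h2

variable [NormedSpace ℝ E] [NormedSpace ℝ F]

theorem locHolderAt_of_contDiffAt {f : E → F} (hα1 : α ≤ 1) (hf : ContDiffAt ℝ 1 f x) :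
    LocHolderAt α f x :=
  (hf.hasStrictFDerivAt one_ne_zero).isBigO_sub.trans (isBigO_sub_rpow hα1)

theorem LocHolderAt.comp {g : F → G} {f : E → F} (hα : 0 ≤ α) (hg : LocHolderAt α g (f x))
    (hf : ContDiffAt ℝ 1 f x) : LocHolderAt α (g ∘ f) x := by
  have h1 : Tendsto (fun q : E × E => (f q.1, f q.2)) (𝓝 (x, x)) (𝓝 (f x, f x)) := by
    have := hf.continuousAt
    rw [nhds_prod_eq, nhds_prod_eq]
    exact Tendsto.prodMap this this
  refine (hg.comp_tendsto h1).trans ?_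
  have h2 := (hf.hasStrictFDerivAt one_ne_zero).isBigO_sub.norm_norm
  exact h2.rpow hα (Eventually.of_forall fun q => norm_nonneg _)

theorem CkHolderAt.congr {f g : E → F} (hf : CkHolderAt k α f x) (h : f =ᶠ[𝓝 x] g) :
    CkHolderAt k α g x :=
  ⟨hf.1.congr_of_eventuallyEq h.symm, hf.2.congr (h.iteratedFDeriv ℝ k)⟩

theorem CkHolderAt.of_contDiffAt {f : E → F} (hα1 : α ≤ 1) (hf : ContDiffAt ℝ (k + 1) f x) :
    CkHolderAt k α f x :=
  ⟨hf.of_le (by exact_mod_cast Nat.le_succ k), locHolderAt_of_contDiffAt hα1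
    (hf.iteratedFDeriv_right (by rw [add_comm]))⟩

theorem CkHolderAt.of_succ {f : E → F} (hα1 : α ≤ 1) (hf : CkHolderAt (k + 1) α f x) :
    CkHolderAt k α f x :=
  .of_contDiffAt hα1 (by exact_mod_cast hf.1)

theorem ckHolderAt_zero_iff {f : E → F} (hα : 0 < α) :
    CkHolderAt 0 α f x ↔ LocHolderAt α f x := by
  have e : ∀ y z, ‖iteratedFDeriv ℝ 0 f y - iteratedFDeriv ℝ 0 f z‖ = ‖f y - f z‖ := by
    intro y z
    simp only [iteratedFDeriv_zero_eq_comp, Function.comp_apply, ← map_sub,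
      LinearIsometryEquiv.norm_map]
  refine ⟨fun h => h.2.of_norm_sub_le fun y z => (e y z).ge, fun h => ⟨?_, ?_⟩⟩
  · refine contDiffAt_zero.2 ⟨_, h.eventually, fun y hy => ?_⟩
    exact (LocHolderAt.continuousAt hα hy).continuousWithinAt
  · exact h.of_norm_sub_le fun y z => (e y z).le

theorem ckHolderAt_succ_iff {f : E → F} :
    CkHolderAt (k + 1) α f x ↔
      ∃ f' : E → E →L[ℝ] F, (∀ᶠ y in 𝓝 x, HasFDerivAt f (f' y) y) ∧ CkHolderAt k α f' x := by
  have e : ∀ y z, ‖iteratedFDeriv ℝ (k + 1) f y - iteratedFDeriv ℝ (k + 1) f z‖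
      = ‖iteratedFDeriv ℝ k (fderiv ℝ f) y - iteratedFDeriv ℝ k (fderiv ℝ f) z‖ := by
    intro y z
    simp only [iteratedFDeriv_succ_eq_comp_right, Function.comp_apply]
    rw [← dist_eq_norm, LinearIsometryEquiv.dist_map, dist_eq_norm]
  constructor
  · rintro ⟨h1, h2⟩
    have h1' : ContDiffAt ℝ ((k : WithTop ℕ∞) + 1) f x := by exact_mod_cast h1
    refine ⟨fderiv ℝ f, ?_, h1'.fderiv_right_succ, h2.of_norm_sub_le fun y z => (e y z).ge⟩
    have h3 : ContDiffAt ℝ 1 f x := h1'.of_le (by simp)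
    filter_upwards [h3.eventually (by simp)] with y hy
    exact (hy.differentiableAt one_ne_zero).hasFDerivAt
  · rintro ⟨f', h1, h2, h3⟩
    have h4 : f' =ᶠ[𝓝 x] fderiv ℝ f := h1.mono fun y hy => hy.fderiv.symm
    refine ⟨?_, ?_⟩
    · have := contDiffAt_succ_iff_hasFDerivAt.2 ⟨f', ⟨_, h1, fun y hy => hy⟩, h2⟩
      exact_mod_cast this
    · exact (h3.congr (h4.iteratedFDeriv ℝ k)).of_norm_sub_le fun y z => (e y z).le

theorem CkHolderAt.add {f g : E → F} (hf : CkHolderAt k α f x) (hg : CkHolderAt k α g x) :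
    CkHolderAt k α (fun y => f y + g y) x := by
  refine ⟨hf.1.add hg.1, ?_⟩
  have h1 : ∀ᶠ y in 𝓝 x, iteratedFDeriv ℝ k (fun y => f y + g y) y =
      iteratedFDeriv ℝ k f y + iteratedFDeriv ℝ k g y := by
    filter_upwards [hf.1.eventually (by simp), hg.1.eventually (by simp)] with y h1 h2
    exact iteratedFDeriv_add_apply h1 h2
  refine LocHolderAt.congr ?_ (EventuallyEq.symm h1)
  exact (IsBigO.add hf.2 hg.2).congr_left fun q => (add_sub_add_comm _ _ _ _).symm

end

theorem CkHolderAt.bilinear {E : Type} [NormedAddCommGroup E] [NormedSpace ℝ E] {α : ℝ}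
    (hα : 0 < α) (hα1 : α ≤ 1) {x : E} (k : ℕ) :
    ∀ {F G H : Type} [NormedAddCommGroup F] [NormedSpace ℝ F] [NormedAddCommGroup G]
      [NormedSpace ℝ G] [NormedAddCommGroup H] [NormedSpace ℝ H] {f : E → F} {g : E → G}
      (B : F →L[ℝ] G →L[ℝ] H), CkHolderAt k α f x → CkHolderAt k α g x →
      CkHolderAt k α (fun y => B (f y) (g y)) x := by
  induction k with
  | zero =>
    intro F G H _ _ _ _ _ _ f g B hf hg
    rw [ckHolderAt_zero_iff hα] at *
    exact hf.bilinear B hα hg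
  | succ k ih =>
    intro F G H _ _ _ _ _ _ f g B hf hg
    obtain ⟨f', hf1, hf2⟩ := ckHolderAt_succ_iff.1 hf
    obtain ⟨g', hg1, hg2⟩ := ckHolderAt_succ_iff.1 hg
    refine ckHolderAt_succ_iff.2 ⟨fun y => B.precompR E (f y) (g' y) + B.precompL E (f' y) (g y),
      ?_, (ih (B.precompR E) (hf.of_succ hα1) hg2).add (ih (B.precompL E) hf2 (hg.of_succ hα1))⟩
    filter_upwards [hf1, hg1] with y h1 h2
    exact B.hasFDerivAt_of_bilinear h1 h2

theorem CkHolderAt.comp {E F : Type} [NormedAddCommGroup E] [NormedSpace ℝ E]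
    [NormedAddCommGroup F] [NormedSpace ℝ F] {α : ℝ}
    (hα : 0 < α) (hα1 : α ≤ 1) {x : E} {f : E → F} (hf1 : ContDiffAt ℝ 1 f x) (k : ℕ) :
    ∀ {G : Type} [NormedAddCommGroup G] [NormedSpace ℝ G] {g : F → G},
      CkHolderAt k α g (f x) → CkHolderAt k α f x → CkHolderAt k α (fun y => g (f y)) x := by
  induction k with
  | zero =>
    intro G _ _ g hg hf
    rw [ckHolderAt_zero_iff hα] at *
    exact hg.comp hα.le hf1
  | succ k ih =>
    intro G _ _ g hg hf
    obtain ⟨f', hf1, hf2⟩ := ckHolderAt_succ_iff.1 hf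
    obtain ⟨g', hg1, hg2⟩ := ckHolderAt_succ_iff.1 hg
    refine ckHolderAt_succ_iff.2 ⟨fun y => (g' (f y)).comp (f' y), ?_,
      CkHolderAt.bilinear hα hα1 k (ContinuousLinearMap.compL ℝ E F G)
        (ih hg2 (hf.of_succ hα1)) hf2⟩
    filter_upwards [hf1, hf.1.continuousAt.eventually hg1] with y h1 h2
    exact h2.comp y h1

section

variable {E F G : Type} [NormedAddCommGroup E] [NormedSpace ℝ E] [NormedAddCommGroup F]
  [NormedSpace ℝ F] [NormedAddCommGroup G] [NormedSpace ℝ G] {α : ℝ} {k : ℕ} {x : E}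

theorem CkHolderAt.clm_comp {f : E → F} (hf : CkHolderAt k α f x) (L : F →L[ℝ] G) :
    CkHolderAt k α (fun y => L (f y)) x := by
  refine ⟨L.contDiff.contDiffAt.comp x hf.1, ?_⟩
  have h1 : ∀ᶠ y in 𝓝 x, iteratedFDeriv ℝ k (fun y => L (f y)) y =
      L.compContinuousMultilinearMap (iteratedFDeriv ℝ k f y) := by
    filter_upwards [hf.1.eventually (by simp)] with y hy
    exact L.iteratedFDeriv_comp_left hy le_rfl
  refine LocHolderAt.congr ?_ (EventuallyEq.symm h1)
  refine IsBigO.trans (IsBigO.of_bound ‖L‖ (Eventually.of_forall fun q => ?_)) hf.2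
  refine le_trans (le_of_eq ?_) (L.norm_compContinuousMultilinearMap_le _)
  congr 1
  ext m
  simp

theorem CkHolderAt.prodMk {f : E → F} {g : E → G} (hf : CkHolderAt k α f x)
    (hg : CkHolderAt k α g x) : CkHolderAt k α (fun y => (f y, g y)) x := by
  have := (hf.clm_comp (.inl ℝ F G)).add (hg.clm_comp (.inr ℝ F G))
  simpa using this

/-- Integrating an ordinary differential equation gains one derivative. -/
theorem CkHolderAt.of_hasDerivAt {f f' : ℝ → ℝ} {t : ℝ}
    (h : ∀ᶠ s in 𝓝 t, HasDerivAt f (f' s) s) (hf' : CkHolderAt k α f' t) :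
    CkHolderAt (k + 1) α f t := by
  refine ckHolderAt_succ_iff.2
    ⟨fun s => ContinuousLinearMap.toSpanSingletonCLE (𝕜 := ℝ) (f' s), ?_, ?_⟩
  · filter_upwards [h] with s hs
    exact hs.hasFDerivAt
  · exact hf'.clm_comp
      (ContinuousLinearMap.toSpanSingletonCLE (𝕜 := ℝ) (E := ℝ)).toContinuousLinearMap

theorem holderClassOn_univ_of_ckHolderAt {α : ℝ≥0} (hα : 0 < α) {f : E → ℝ}
    (hf : ∀ y, CkHolderAt k α f y) : RadialGraph.HolderClassOn k α f univ := by
  refine ⟨fun y _ => (hf y).1.contDiffWithinAt, fun K _ hK => ?_⟩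
  rw [iteratedFDerivWithin_univ]
  exact exists_holderOnWith_of_locHolderAt hα hK fun y _ => (hf y).2

theorem ckHolderAt_of_holderClassOn [ProperSpace E] {α : ℝ≥0} {f : E → ℝ} {s : Set E}
    (hf : RadialGraph.HolderClassOn k α f s) (hx : s ∈ 𝓝 x) : CkHolderAt k α f x := by
  refine ⟨hf.1.contDiffAt hx, ?_⟩
  obtain ⟨r, hr, hrs⟩ := Metric.nhds_basis_closedBall.mem_iff.1 hx
  obtain ⟨C, hC⟩ := hf.2 _ hrs (isCompact_closedBall x r)
  have h1 : LocHolderAt α (iteratedFDerivWithin ℝ k f s) x := by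
    refine IsBigO.of_bound C ?_
    have : Metric.closedBall x r ×ˢ Metric.closedBall x r ∈ 𝓝 (x, x) :=
      prod_mem_nhds (Metric.closedBall_mem_nhds x hr) (Metric.closedBall_mem_nhds x hr)
    filter_upwards [this] with q hq
    rw [Real.norm_of_nonneg (by positivity), ← dist_eq_norm, ← dist_eq_norm]
    exact hC.dist_le hq.1 hq.2
  refine h1.congr ?_
  filter_upwards [eventually_mem_nhds_iff.2 hx] with y hy
  have : s =ᶠ[𝓝 y] univ := eventuallyEq_univ.2 hy
  rw [iteratedFDerivWithin_congr_set this, iteratedFDerivWithin_univ]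

end
end HolderGerm

/-! ### Briot–Bouquet equations -/

namespace BriotBouquet

open Filter Topology Set MeasureTheory

/-- The weighted radial average `∫₀¹ τ^{λ-1} f(τ z) dτ`. It inverts the Euler operator
`f ↦ z f' + λ f` on functions holomorphic near `0`. -/
def eulerInv (lam : ℝ) (f : ℂ → ℂ) (z : ℂ) : ℂ :=
  ∫ τ in (0 : ℝ)..1, ((τ ^ (lam - 1) : ℝ) : ℂ) * f (τ * z)

variable {lam δ : ℝ} {f g : ℂ → ℂ} {z : ℂ}

theorem smul_mem_ball {τ : ℝ} (h0 : 0 ≤ τ) (h1 : τ ≤ 1) (hz : z ∈ Metric.ball (0 : ℂ) δ) :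
    (τ : ℂ) * z ∈ Metric.ball (0 : ℂ) δ := by
  rw [mem_ball_zero_iff] at *
  rw [norm_mul, Complex.norm_real, Real.norm_of_nonneg h0]
  exact (mul_le_of_le_one_left (norm_nonneg z) h1).trans_lt hz

theorem continuous_rpow_ofReal (hlam : 1 ≤ lam) :
    Continuous fun τ : ℝ => ((τ ^ (lam - 1) : ℝ) : ℂ) :=
  Complex.continuous_ofReal.comp (continuous_id.rpow_const fun _ => Or.inr (by linarith))

theorem continuousOn_comp_smul (hf : ContinuousOn f (Metric.ball 0 δ))
    (hz : z ∈ Metric.ball (0 : ℂ) δ) :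
    ContinuousOn (fun τ : ℝ => f (τ * z)) (Icc 0 1) :=
  hf.comp (by fun_prop) fun τ hτ => smul_mem_ball hτ.1 hτ.2 hz

theorem intervalIntegrable_eulerInv (hlam : 1 ≤ lam) (hf : ContinuousOn f (Metric.ball 0 δ))
    (hz : z ∈ Metric.ball (0 : ℂ) δ) :
    IntervalIntegrable (fun τ : ℝ => ((τ ^ (lam - 1) : ℝ) : ℂ) * f (τ * z)) volume 0 1 := by
  apply ContinuousOn.intervalIntegrable
  rw [uIcc_of_le zero_le_one]
  exact (continuous_rpow_ofReal hlam).continuousOn.mul (continuousOn_comp_smul hf hz)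

theorem hasDerivAt_eulerInv (hlam : 1 ≤ lam) (hf : DifferentiableOn ℂ f (Metric.ball 0 δ))
    (hz : z ∈ Metric.ball (0 : ℂ) δ) :
    HasDerivAt (eulerInv lam f)
      (∫ τ in (0 : ℝ)..1, ((τ ^ (lam - 1) : ℝ) : ℂ) * (deriv f (τ * z) * τ)) z := by
  have hfc := hf.continuousOn
  have hd : ContinuousOn (deriv f) (Metric.ball 0 δ) :=
    (hf.deriv Metric.isOpen_ball).continuousOn
  rw [mem_ball_zero_iff] at hz
  obtain ⟨r, hzr, hr⟩ := exists_between hz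
  have hsub : Metric.closedBall (0 : ℂ) r ⊆ Metric.ball 0 δ := Metric.closedBall_subset_ball hr
  obtain ⟨M, hM⟩ := (isCompact_closedBall (0 : ℂ) r).exists_bound_of_continuousOn (hd.mono hsub)
  have hball : ∀ {w : ℂ}, w ∈ Metric.ball (0 : ℂ) r → w ∈ Metric.ball (0 : ℂ) δ := fun hw =>
    hsub (Metric.ball_subset_closedBall hw)
  have hs : Metric.ball (0 : ℂ) r ∈ 𝓝 z := Metric.isOpen_ball.mem_nhds (by simpa using hzr)
  have hzb : z ∈ Metric.ball (0 : ℂ) δ := by simpa using hz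
  have hd' : ContinuousOn (fun τ : ℝ => ((τ ^ (lam - 1) : ℝ) : ℂ) * (deriv f (τ * z) * τ))
      (Icc 0 1) := (continuous_rpow_ofReal hlam).continuousOn.mul
        ((continuousOn_comp_smul hd hzb).mul (by fun_prop))
  refine (intervalIntegral.hasDerivAt_integral_of_dominated_loc_of_deriv_le (s := Metric.ball 0 r)
    (F := fun w (τ : ℝ) => ((τ ^ (lam - 1) : ℝ) : ℂ) * f (τ * w))
    (F' := fun w (τ : ℝ) => ((τ ^ (lam - 1) : ℝ) : ℂ) * (deriv f (τ * w) * τ))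
    (bound := fun _ => M) hs ?_ (intervalIntegrable_eulerInv hlam hfc hzb) ?_ ?_ ?_ ?_).2
  · filter_upwards [hs] with w hw
    rw [uIoc_of_le zero_le_one]
    have := (intervalIntegrable_eulerInv hlam hfc (hball hw)).1
    exact this.aestronglyMeasurable
  · rw [uIoc_of_le zero_le_one]
    exact (hd'.mono Ioc_subset_Icc_self).aestronglyMeasurable measurableSet_Ioc
  · refine Eventually.of_forall fun τ hτ w hw => ?_
    rw [uIoc_of_le zero_le_one] at hτ
    have h1 := hM _ (Metric.ball_subset_closedBall (smul_mem_ball hτ.1.le hτ.2 hw))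
    have h2 : τ ^ (lam - 1) ≤ 1 := Real.rpow_le_one hτ.1.le hτ.2 (by linarith)
    have h3 : 0 ≤ τ ^ (lam - 1) := Real.rpow_nonneg hτ.1.le _
    rw [norm_mul, norm_mul, Complex.norm_real, Complex.norm_real, Real.norm_of_nonneg h3,
      Real.norm_of_nonneg hτ.1.le]
    have h4 : 0 ≤ M := (norm_nonneg _).trans h1
    calc τ ^ (lam - 1) * (‖deriv f (τ * w)‖ * τ) ≤ 1 * (M * 1) := by
          exact mul_le_mul h2 (mul_le_mul h1 hτ.2 hτ.1.le h4)
            (mul_nonneg (norm_nonneg _) hτ.1.le) zero_le_one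
      _ = M := by ring
  · simp
  · refine Eventually.of_forall fun τ hτ w hw => ?_
    rw [uIoc_of_le zero_le_one] at hτ
    have h1 := (hf.differentiableAt (Metric.isOpen_ball.mem_nhds
      (smul_mem_ball hτ.1.le hτ.2 (hball hw)))).hasDerivAt
    have h2 : HasDerivAt (fun w : ℂ => (τ : ℂ) * w) τ w := by
      simpa using (hasDerivAt_id w).const_mul (τ : ℂ)
    exact (h1.comp w h2).const_mul _

/-- `eulerInv lam f` solves the Euler equation `z u' + λ u = f`. -/
theorem euler_eulerInv (hlam : 1 ≤ lam) (hf : DifferentiableOn ℂ f (Metric.ball 0 δ))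
    (hz : z ∈ Metric.ball (0 : ℂ) δ) :
    z * deriv (eulerInv lam f) z + lam * eulerInv lam f z = f z := by
  have hfc := hf.continuousOn
  have hd : ContinuousOn (deriv f) (Metric.ball 0 δ) :=
    (hf.deriv Metric.isOpen_ball).continuousOn
  have hd' : ContinuousOn (fun τ : ℝ => ((τ ^ (lam - 1) : ℝ) : ℂ) * (deriv f (τ * z) * τ))
      (Icc 0 1) := (continuous_rpow_ofReal hlam).continuousOn.mul
        ((continuousOn_comp_smul hd hz).mul (by fun_prop))
  have i1 : IntervalIntegrable (fun τ : ℝ => z * (((τ ^ (lam - 1) : ℝ) : ℂ) *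
      (deriv f (τ * z) * τ))) volume 0 1 := by
    apply ContinuousOn.intervalIntegrable
    rw [uIcc_of_le zero_le_one]
    exact continuousOn_const.mul hd'
  have i2 := (intervalIntegrable_eulerInv hlam hfc hz).const_mul (lam : ℂ)
  rw [(hasDerivAt_eulerInv hlam hf hz).deriv, eulerInv, ← intervalIntegral.integral_const_mul,
    ← intervalIntegral.integral_const_mul, ← intervalIntegral.integral_add i1 i2]
  -- The integrand is the derivative of `τ ↦ τ^λ f(τ z)`.
  rw [intervalIntegral.integral_eq_sub_of_hasDerivAt
    (f := fun τ : ℝ => ((τ ^ lam : ℝ) : ℂ) * f (τ * z)) _ (i1.add i2)]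
  · simp [Real.zero_rpow (by linarith : lam ≠ 0)]
  · intro τ hτ
    rw [uIcc_of_le zero_le_one] at hτ
    have h1 := (hf.differentiableAt (Metric.isOpen_ball.mem_nhds
      (smul_mem_ball hτ.1 hτ.2 hz))).hasDerivAt
    have h2 : HasDerivAt (fun τ : ℝ => (τ : ℂ) * z) z τ := by
      simpa using (Complex.ofRealCLM.hasDerivAt (x := τ)).mul_const z
    have h3 : HasDerivAt (fun τ : ℝ => ((τ ^ lam : ℝ) : ℂ)) ((lam * τ ^ (lam - 1) : ℝ) : ℂ) τ :=
      (Real.hasDerivAt_rpow_const (Or.inr hlam)).ofReal_comp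
    have h4 : τ ^ lam = τ ^ (lam - 1) * τ := by
      rcases hτ.1.eq_or_lt with h | h
      · rw [← h, Real.zero_rpow (by linarith), mul_zero]
      · rw [← Real.rpow_add_one h.ne']; ring_nf
    refine (h3.mul (h1.comp τ h2)).congr_deriv ?_
    rw [h4]
    push_cast
    simp only [Function.comp_apply]
    ring

theorem norm_eulerInv_sub_le {M : ℝ} (hlam : 1 ≤ lam) (hf : ContinuousOn f (Metric.ball 0 δ))
    (hg : ContinuousOn g (Metric.ball 0 δ)) (hz : z ∈ Metric.ball (0 : ℂ) δ)
    (h : ∀ w ∈ Metric.ball (0 : ℂ) δ, ‖f w - g w‖ ≤ lam * M) :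
    ‖eulerInv lam f z - eulerInv lam g z‖ ≤ M := by
  rw [eulerInv, eulerInv, ← intervalIntegral.integral_sub (intervalIntegrable_eulerInv hlam hf hz)
    (intervalIntegrable_eulerInv hlam hg hz)]
  have hi : IntervalIntegrable (fun τ : ℝ => τ ^ (lam - 1) * (lam * M)) volume 0 1 :=
    (Continuous.intervalIntegrable (continuous_id.rpow_const fun _ => Or.inr (by linarith))
      0 1).mul_const _
  refine (intervalIntegral.norm_integral_le_of_norm_le zero_le_one
    (Eventually.of_forall fun τ hτ => ?_) hi).trans_eq ?_
  · rw [← mul_sub, norm_mul, Complex.norm_real,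
      Real.norm_of_nonneg (Real.rpow_nonneg hτ.1.le _)]
    exact mul_le_mul_of_nonneg_left (h _ (smul_mem_ball hτ.1.le hτ.2 hz))
      (Real.rpow_nonneg hτ.1.le _)
  · have h0 : lam ≠ 0 := by linarith
    rw [intervalIntegral.integral_mul_const, integral_rpow (Or.inl (by linarith))]
    simp [Real.zero_rpow h0]
    field_simp

theorem eulerInv_const (hlam : 1 ≤ lam) (c : ℂ) : eulerInv lam (fun _ => lam * c) z = c := by
  have h0 : lam ≠ 0 := by linarith
  have h0' : (lam : ℂ) ≠ 0 := by exact_mod_cast h0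
  rw [eulerInv, intervalIntegral.integral_mul_const, intervalIntegral.integral_ofReal,
    integral_rpow (Or.inl (by linarith))]
  simp [Real.zero_rpow h0]
  field_simp

theorem exists_eulerInv_eq_ofReal {x : ℝ} (hx : |x| < δ)
    (hf : ∀ y : ℝ, |y| < δ → ∃ r : ℝ, f y = r) : ∃ r : ℝ, eulerInv lam f x = r := by
  refine ⟨∫ τ in (0 : ℝ)..1, τ ^ (lam - 1) * (f (τ * x)).re, ?_⟩
  rw [← intervalIntegral.integral_ofReal]
  refine intervalIntegral.integral_congr fun τ hτ => ?_
  rw [uIcc_of_le zero_le_one] at hτ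
  obtain ⟨r, hr⟩ := hf (τ * x) (by
    rw [abs_mul, abs_of_nonneg hτ.1]
    exact (mul_le_of_le_one_left (abs_nonneg x) hτ.2).trans_lt hx)
  push_cast at hr ⊢
  simp [hr]

/-- **Briot–Bouquet.** The singular equation `z u' + λ u = H(z, u)`, where `H` is holomorphic near
`(0, p₀)`, `H(0, p₀) = λ p₀`, `∂_u H(0, p₀) = 0` and `λ ≥ 1`, has a holomorphic solution with
`u(0) = p₀`. It is the limit of the iterates of `u ↦ eulerInv λ (H(·, u))`, and it is real on the
real axis if `H` is. -/
theorem exists_solution (hlam : 1 ≤ lam) {H : ℂ × ℂ → ℂ} {p₀ : ℝ}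
    (hH : ContDiffAt ℂ 1 H (0, (p₀ : ℂ))) (h0 : H (0, p₀) = lam * p₀)
    (hd : HasDerivAt (fun q => H (0, q)) 0 (p₀ : ℂ))
    (hreal : ∀ x y : ℝ, ∃ r : ℝ, H (x, y) = r) :
    ∃ δ > 0, ∃ u : ℂ → ℂ, DifferentiableOn ℂ u (Metric.ball 0 δ) ∧ u 0 = p₀ ∧
      (∀ x : ℝ, |x| < δ → ∃ r : ℝ, u x = r) ∧
      ∀ z ∈ Metric.ball (0 : ℂ) δ, z * deriv u z + lam * u z = H (z, u z) := by
  have hlam0 : 0 < lam := by linarith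
  -- `H` is Lipschitz in the second variable with constant `λ / 2` near `(0, p₀)`.
  have hst := hH.hasStrictFDerivAt one_ne_zero
  have hL : fderiv ℂ H (0, (p₀ : ℂ)) (0, 1) = 0 := by
    have h1 : HasDerivAt (fun q : ℂ => ((0 : ℂ), q)) (0, 1) (p₀ : ℂ) :=
      (hasDerivAt_const _ _).prodMk (hasDerivAt_id _)
    exact (hst.hasFDerivAt.comp_hasDerivAt _ h1).unique hd
  have hev := hst.isLittleO.bound (half_pos hlam0)
  have hdiff : ∀ᶠ q in 𝓝 ((0 : ℂ), (p₀ : ℂ)), DifferentiableAt ℂ H q :=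
    (hH.eventually (by simp)).mono fun q hq => hq.differentiableAt one_ne_zero
  rw [nhds_prod_eq] at hev
  obtain ⟨s, hs, hs'⟩ := mem_prod_same_iff.1 hev
  obtain ⟨ε₁, hε₁, hb₁⟩ := Metric.mem_nhds_iff.1 (hdiff.and hs)
  obtain ⟨ρ, hρ, hρε⟩ := exists_between hε₁
  have hmem : ∀ {z q : ℂ}, ‖z‖ < ε₁ → ‖q - p₀‖ ≤ ρ →
      DifferentiableAt ℂ H (z, q) ∧ (z, q) ∈ s := by
    intro z q hz hq
    refine hb₁ ?_
    rw [Metric.mem_ball, Prod.dist_eq, max_lt_iff, dist_zero_right, dist_eq_norm]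
    exact ⟨hz, hq.trans_lt hρε⟩
  have hlip : ∀ {z q q' : ℂ}, ‖z‖ < ε₁ → ‖q - p₀‖ ≤ ρ → ‖q' - p₀‖ ≤ ρ →
      ‖H (z, q) - H (z, q')‖ ≤ lam / 2 * ‖q - q'‖ := by
    intro z q q' hz hq hq'
    have h1 : (((z, q), (z, q')) : (ℂ × ℂ) × ℂ × ℂ) ∈ s ×ˢ s :=
      ⟨(hmem hz hq).2, (hmem hz hq').2⟩
    have h2 := hs' h1
    have h3 : ((z, q) : ℂ × ℂ) - (z, q') = (q - q') • ((0 : ℂ), (1 : ℂ)) := by simp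
    simp only [mem_ofPred_eq, h3, map_smul, hL, smul_zero, sub_zero] at h2
    simpa [norm_smul] using h2
  obtain ⟨δ, hδ, hδε, hδH⟩ : ∃ δ > 0, δ ≤ ε₁ ∧
      ∀ z : ℂ, ‖z‖ < δ → ‖H (z, p₀) - lam * p₀‖ ≤ lam * (ρ / 2) := by
    have hc : ContinuousAt (fun z : ℂ => H (z, p₀)) 0 :=
      ContinuousAt.comp (f := fun z : ℂ => (z, (p₀ : ℂ))) hH.continuousAt (by fun_prop)
    obtain ⟨δ, hδ, h⟩ := Metric.continuousAt_iff.1 hc (lam * (ρ / 2)) (by positivity)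
    refine ⟨min δ ε₁, lt_min hδ hε₁, min_le_right _ _, fun z hz => ?_⟩
    have := h (x := z) (by simpa using hz.trans_le (min_le_left _ _))
    rw [dist_eq_norm, h0] at this
    exact this.le
  set B := Metric.ball (0 : ℂ) δ with hB
  have hBε : ∀ {z : ℂ}, z ∈ B → ‖z‖ < ε₁ := fun hz => (mem_ball_zero_iff.1 hz).trans_le hδε
  -- The set of functions preserved by the iteration.
  let Good : (ℂ → ℂ) → Prop := fun f => DifferentiableOn ℂ f B ∧ (∀ z ∈ B, ‖f z - p₀‖ ≤ ρ) ∧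
    ∀ x : ℝ, |x| < δ → ∃ r : ℝ, f x = r
  have hHd : ∀ {f}, Good f → DifferentiableOn ℂ (fun z => H (z, f z)) B := by
    intro f hf z hz
    exact (hmem (hBε hz) (hf.2.1 z hz)).1.comp_differentiableWithinAt z
      (differentiableWithinAt_id.prodMk (hf.1 z hz))
  let T : (ℂ → ℂ) → ℂ → ℂ := fun f => eulerInv lam fun z => H (z, f z)
  have hTlip : ∀ {f g M}, Good f → Good g → (∀ z ∈ B, ‖f z - g z‖ ≤ M) →
      ∀ z ∈ B, ‖T f z - T g z‖ ≤ M / 2 := by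
    intro f g M hf hg h z hz
    refine norm_eulerInv_sub_le hlam (hHd hf).continuousOn (hHd hg).continuousOn hz fun w hw => ?_
    calc _ ≤ lam / 2 * ‖f w - g w‖ := hlip (hBε hw) (hf.2.1 w hw) (hg.2.1 w hw)
      _ ≤ lam / 2 * M := by gcongr; exact h w hw
      _ = _ := by ring
  have hgood0 : Good fun _ => (p₀ : ℂ) :=
    ⟨differentiableOn_const _, fun z _ => by simpa using hρ.le, fun x _ => ⟨p₀, rfl⟩⟩
  have hTgood : ∀ {f}, Good f → Good (T f) := by
    intro f hf
    refine ⟨fun z hz =>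
        (hasDerivAt_eulerInv hlam (hHd hf) hz).differentiableAt.differentiableWithinAt,
      fun z hz => ?_, fun x hx => exists_eulerInv_eq_ofReal hx fun y hy => ?_⟩
    · have h1 := hTlip hf hgood0 hf.2.1 z hz
      have h2 : ‖T (fun _ => (p₀ : ℂ)) z - eulerInv lam (fun _ => lam * (p₀ : ℂ)) z‖ ≤ ρ / 2 :=
        norm_eulerInv_sub_le hlam (hHd hgood0).continuousOn continuousOn_const hz fun w hw =>
          hδH w (mem_ball_zero_iff.1 hw)
      rw [eulerInv_const hlam] at h2
      calc _ = ‖(T f z - T (fun _ => (p₀ : ℂ)) z) + (T (fun _ => (p₀ : ℂ)) z - p₀)‖ := by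
            congr 1; ring
        _ ≤ _ := norm_add_le _ _
        _ ≤ ρ / 2 + ρ / 2 := add_le_add h1 h2
        _ = ρ := by ring
    · obtain ⟨r, hr⟩ := hf.2.2 y hy
      obtain ⟨r', hr'⟩ := hreal y r
      exact ⟨r', by simp only [hr, hr']⟩
  let F : ℕ → ℂ → ℂ := fun k => T^[k] fun _ => (p₀ : ℂ)
  have hFs : ∀ k, F (k + 1) = T (F k) := fun k => Function.iterate_succ_apply' T k _
  have hF : ∀ k, Good (F k) := by
    intro k
    induction k with
    | zero => exact hgood0
    | succ k ih => rw [hFs]; exact hTgood ih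
  have hstep : ∀ k, ∀ z ∈ B, ‖F k z - F (k + 1) z‖ ≤ 2 * ρ / 2 / 2 ^ k := by
    intro k
    induction k with
    | zero =>
      intro z hz
      have := (hF 1).2.1 z hz
      rw [norm_sub_rev] at this
      refine this.trans_eq ?_
      simp
    | succ k ih =>
      intro z hz
      have := hTlip (hF k) (hF (k + 1)) ih z hz
      rw [← hFs, ← hFs] at this
      refine this.trans_eq ?_
      rw [pow_succ]; field_simp
  have hlim : ∀ z ∈ B, ∃ a, Tendsto (fun k => F k z) atTop (𝓝 a) := fun z hz =>
    cauchySeq_tendsto_of_complete (cauchySeq_of_le_geometric_two (C := 2 * ρ) fun k => by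
      rw [dist_eq_norm]; exact hstep k z hz)
  choose! u hu using hlim
  have hbound : ∀ k, ∀ z ∈ B, ‖F k z - u z‖ ≤ 2 * ρ / 2 ^ k := by
    intro k z hz
    rw [← dist_eq_norm]
    exact dist_le_of_le_geometric_two_of_tendsto (C := 2 * ρ)
      (fun k => by rw [dist_eq_norm]; exact hstep k z hz) (hu z hz) k
  have hzero : Tendsto (fun k : ℕ => 2 * ρ / 2 ^ k) atTop (𝓝 0) := by
    have := tendsto_pow_atTop_nhds_zero_of_lt_one (r := (1 / 2 : ℝ)) (by norm_num) (by norm_num)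
    simpa [div_eq_mul_inv] using this.const_mul (2 * ρ)
  have hunif : TendstoUniformlyOn F u atTop B := by
    rw [Metric.tendstoUniformlyOn_iff]
    intro ε hε
    filter_upwards [hzero.eventually_lt_const hε] with k hk z hz
    rw [dist_comm, dist_eq_norm]
    exact (hbound k z hz).trans_lt hk
  have hugood : Good u := by
    refine ⟨hunif.tendstoLocallyUniformlyOn.differentiableOn
      (Eventually.of_forall fun k => (hF k).1) Metric.isOpen_ball, fun z hz => ?_, fun x hx => ?_⟩
    · exact le_of_tendsto ((hu z hz).sub_const _).norm
        (Eventually.of_forall fun k => (hF k).2.1 z hz)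
    · have hx' : (x : ℂ) ∈ B := by simpa [hB] using hx
      have hmem : u x ∈ range ((↑) : ℝ → ℂ) :=
        IsClosed.mem_of_tendsto
          Complex.isUniformEmbedding_ofReal.isClosedEmbedding.isClosed_range (hu x hx')
          (Eventually.of_forall fun k => by
            obtain ⟨r, hr⟩ := (hF k).2.2 x hx
            exact ⟨r, hr.symm⟩)
      obtain ⟨r, hr⟩ := hmem
      exact ⟨r, hr.symm⟩
  have hfix : ∀ z ∈ B, u z = T u z := by
    intro z hz
    have h1 : Tendsto (fun k => F (k + 1) z) atTop (𝓝 (T u z)) := by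
      refine tendsto_iff_norm_sub_tendsto_zero.2 (squeeze_zero (fun k => norm_nonneg _)
        (fun k => ?_) (by simpa using hzero.div_const 2))
      rw [hFs]
      exact hTlip (hF k) hugood (hbound k) z hz
    exact tendsto_nhds_unique ((tendsto_add_atTop_iff_nat 1).2 (hu z hz)) h1
  have heq : ∀ z ∈ B, z * deriv u z + lam * u z = H (z, u z) := by
    intro z hz
    have h1 : u =ᶠ[𝓝 z] T u := by
      filter_upwards [Metric.isOpen_ball.mem_nhds hz] with w hw using hfix w hw
    rw [h1.deriv_eq, hfix z hz, euler_eulerInv hlam (hHd hugood) hz, ← hfix z hz]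
  have hB0 : (0 : ℂ) ∈ B := by simpa [hB] using hδ
  refine ⟨δ, hδ, u, hugood.1, ?_, hugood.2.2, heq⟩
  -- At the origin the equation reads `λ u(0) = H(0, u(0))`, which determines `u(0)`.
  have h1 := heq 0 hB0
  have h2 := hlip (q := u 0) (q' := p₀) (hBε hB0) (hugood.2.1 0 hB0) (by simpa using hρ.le)
  rw [← h1, h0, zero_mul, zero_add, ← mul_sub, norm_mul, Complex.norm_real,
    Real.norm_of_nonneg hlam0.le] at h2
  have h3 : ‖u 0 - p₀‖ ≤ 0 := by nlinarith [norm_nonneg (u 0 - p₀)]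
  exact sub_eq_zero.1 (norm_le_zero_iff.1 h3)

end BriotBouquet

/-! ### The ordinary differential equation of the slope -/

namespace SlopeODE

open Filter Topology Set

/-- The right-hand side of the equation `(c² - 1) p' = slopeRhs n η c p` of the slope `p = dφ/dc`
of a radial function `φ`, in the variable `c = cosh r`, when the curvature is prescribed to be `η`
at `c`. It is a rational expression, and is used over `ℝ` and over `ℂ`. -/
def slopeRhs {𝕜 : Type} [Field 𝕜] (n η c p : 𝕜) : 𝕜 :=
  n / 2 * (1 - p ^ 2 * (c ^ 2 - 1)) *
    (η ^ 2 * (1 - p ^ 2 * (c ^ 2 - 1)) / (1 + p * c) - (1 + p * c)) - c * p ^ 3 * (c ^ 2 - 1)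

theorem contDiffAt_slopeRhs {𝕜 : Type} [NontriviallyNormedField 𝕜] {m : WithTop ℕ∞} (n : 𝕜)
    {x : 𝕜 × 𝕜 × 𝕜} (hx : 1 + x.2.2 * x.2.1 ≠ 0) :
    ContDiffAt 𝕜 m (fun y : 𝕜 × 𝕜 × 𝕜 => slopeRhs n y.1 y.2.1 y.2.2) x := by
  unfold slopeRhs
  have h1 : ContDiffAt 𝕜 m (fun y : 𝕜 × 𝕜 × 𝕜 => y.1) x := contDiffAt_fst
  have h2 : ContDiffAt 𝕜 m (fun y : 𝕜 × 𝕜 × 𝕜 => y.2.1) x := contDiffAt_fst.comp x contDiffAt_snd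
  have h3 : ContDiffAt 𝕜 m (fun y : 𝕜 × 𝕜 × 𝕜 => y.2.2) x := contDiffAt_snd.comp x contDiffAt_snd
  have hw : ContDiffAt 𝕜 m (fun y : 𝕜 × 𝕜 × 𝕜 => 1 - y.2.2 ^ 2 * (y.2.1 ^ 2 - 1)) x :=
    contDiffAt_const.sub ((h3.pow 2).mul ((h2.pow 2).sub contDiffAt_const))
  have hb : ContDiffAt 𝕜 m (fun y : 𝕜 × 𝕜 × 𝕜 => 1 + y.2.2 * y.2.1) x :=
    contDiffAt_const.add (h3.mul h2)
  have hq : ContDiffAt 𝕜 m (fun y : 𝕜 × 𝕜 × 𝕜 =>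
      y.1 ^ 2 * (1 - y.2.2 ^ 2 * (y.2.1 ^ 2 - 1)) / (1 + y.2.2 * y.2.1)) x := by
    simp only [div_eq_mul_inv]
    exact ((h1.pow 2).mul hw).mul (hb.inv hx)
  exact ((contDiffAt_const.mul hw).mul (hq.sub hb)).sub
    ((h2.mul (h3.pow 3)).mul ((h2.pow 2).sub contDiffAt_const))

theorem slopeRhs_one {𝕜 : Type} [Field 𝕜] (n η p : 𝕜) :
    slopeRhs n η 1 p = n / 2 * (η ^ 2 / (1 + p) - (1 + p)) := by
  simp [slopeRhs]

theorem slopeRhs_one_self {𝕜 : Type} [Field 𝕜] (n : 𝕜) {η : 𝕜} (hη : η ≠ 0) :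
    slopeRhs n η 1 (η - 1) = 0 := by
  rw [slopeRhs_one, add_sub_cancel, sq, mul_div_assoc, div_self hη]
  ring

/-- The linearization at the pole `c = 1` is `-n`: the pole attracts nearby solutions. -/
theorem hasDerivAt_slopeRhs_one {𝕜 : Type} [NontriviallyNormedField 𝕜] [CharZero 𝕜] (n : 𝕜) {η : 𝕜}
    (hη : η ≠ 0) : HasDerivAt (fun p => slopeRhs n η 1 p) (-n) (η - 1) := by
  simp only [slopeRhs_one]
  have h1 : HasDerivAt (fun p : 𝕜 => 1 + p) 1 (η - 1) := (hasDerivAt_id _).const_add 1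
  have h2 : (1 : 𝕜) + (η - 1) ≠ 0 := by simpa using hη
  have h3 := (((hasDerivAt_const (η - 1) (η ^ 2)).div h1 h2).sub h1).const_mul (n / 2)
  refine h3.congr_deriv ?_
  rw [add_sub_cancel]
  field_simp
  ring

theorem ofReal_slopeRhs (n η c p : ℝ) :
    ((slopeRhs n η c p : ℝ) : ℂ) = slopeRhs (n : ℂ) η c p := by
  simp [slopeRhs]

/-- Near the pole the right-hand side decreases in the slope. -/
theorem eventually_slopeRhs_sub_mul_nonpos {n η : ℝ} (hn : 0 < n) (hη : 0 < η) :
    ∃ U ∈ 𝓝 ((1 : ℝ), η - 1), ∀ c p q, (c, p) ∈ U → (c, q) ∈ U →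
      (p - q) * (slopeRhs n η c p - slopeRhs n η c q) ≤ 0 := by
  have hx : (1 : ℝ) + (η - 1) * 1 ≠ 0 := by simpa using hη.ne'
  have hcd : ContDiffAt ℝ 1 (fun y : ℝ × ℝ => slopeRhs n η y.1 y.2) (1, η - 1) :=
    ContDiffAt.comp (f := fun y : ℝ × ℝ => (η, y.1, y.2)) (1, η - 1)
      (contDiffAt_slopeRhs (x := (η, 1, η - 1)) n hx) (by fun_prop)
  have hst := hcd.hasStrictFDerivAt one_ne_zero
  have hL : fderiv ℝ (fun y : ℝ × ℝ => slopeRhs n η y.1 y.2) (1, η - 1) (0, 1) = -n := by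
    have h1 : HasDerivAt (fun q : ℝ => ((1 : ℝ), q)) (0, 1) (η - 1) :=
      (hasDerivAt_const _ _).prodMk (hasDerivAt_id _)
    exact (hst.hasFDerivAt.comp_hasDerivAt _ h1).unique (hasDerivAt_slopeRhs_one n hη.ne')
  have hev := hst.isLittleO.bound hn
  rw [nhds_prod_eq] at hev
  obtain ⟨U, hU, hU'⟩ := mem_prod_same_iff.1 hev
  refine ⟨U, hU, fun c p q hp hq => ?_⟩
  have h2 : (((c, p), (c, q)) : (ℝ × ℝ) × ℝ × ℝ) ∈ U ×ˢ U := ⟨hp, hq⟩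
  have h3 := hU' h2
  have h4 : ((c, p) : ℝ × ℝ) - (c, q) = (p - q) • ((0 : ℝ), (1 : ℝ)) := by simp
  simp only [mem_ofPred_eq, h4, map_smul, hL, norm_smul, smul_eq_mul] at h3
  have h5 : ‖((0 : ℝ), (1 : ℝ))‖ = 1 := by simp
  rw [h5, mul_one, Real.norm_eq_abs, Real.norm_eq_abs] at h3
  have h6 := abs_mul (p - q) (slopeRhs n η c p - slopeRhs n η c q - (p - q) * -n)
  have h7 : |p - q| * |slopeRhs n η c p - slopeRhs n η c q - (p - q) * -n| ≤
      |p - q| * (n * |p - q|) := mul_le_mul_of_nonneg_left h3 (abs_nonneg _)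
  rw [← h6] at h7
  have h8 := (le_abs_self _).trans h7
  have h9 : |p - q| * |p - q| = (p - q) * (p - q) := abs_mul_abs_self _
  nlinarith

/-- `p` solves the slope equation on `(1, T)` for the prescribed curvature `g`, stays in the
region of spacelike graphs with positive tangential curvature, and has at the pole the only limit
compatible with a bounded derivative. -/
structure IsSol (n : ℝ) (g p : ℝ → ℝ) (T : ℝ) : Prop where
  spacelike : ∀ c ∈ Ioo 1 T, 0 < 1 - p c ^ 2 * (c ^ 2 - 1)
  pos : ∀ c ∈ Ioo 1 T, 0 < 1 + p c * c
  hasDerivAt : ∀ c ∈ Ioo 1 T, HasDerivAt p (slopeRhs n (g c) c (p c) / (c ^ 2 - 1)) c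
  tendsto : Tendsto p (𝓝[>] 1) (𝓝 (g 1 - 1))

variable {n T T' : ℝ} {g p q : ℝ → ℝ}

theorem sq_sub_one_pos {c : ℝ} (hc : 1 < c) : 0 < c ^ 2 - 1 := by nlinarith

theorem IsSol.mono (h : IsSol n g p T) (hT : T' ≤ T) : IsSol n g p T' :=
  ⟨fun c hc => h.1 c ⟨hc.1, hc.2.trans_le hT⟩, fun c hc => h.2 c ⟨hc.1, hc.2.trans_le hT⟩,
    fun c hc => h.3 c ⟨hc.1, hc.2.trans_le hT⟩, h.4⟩

theorem contDiffAt_slopeField {m : WithTop ℕ∞} (n : ℝ) {x : ℝ × ℝ × ℝ} (hc : 1 < x.2.1)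
    (hx : 1 + x.2.2 * x.2.1 ≠ 0) :
    ContDiffAt ℝ m (fun y : ℝ × ℝ × ℝ => slopeRhs n y.1 y.2.1 y.2.2 / (y.2.1 ^ 2 - 1)) x :=
  (contDiffAt_slopeRhs n hx).div (by fun_prop) (sq_sub_one_pos hc).ne'

theorem IsSol.eventuallyEq_of_eq (hg : ContinuousOn g (Ioi 1)) (hp : IsSol n g p T)
    (hq : IsSol n g q T) {c : ℝ} (hc : c ∈ Ioo 1 T) (h : p c = q c) : p =ᶠ[𝓝 c] q := by
  have hc1 : ContDiffAt ℝ 1 (fun y : ℝ × ℝ × ℝ => slopeRhs n y.1 y.2.1 y.2.2 / (y.2.1 ^ 2 - 1))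
      (g c, c, p c) := contDiffAt_slopeField n hc.1 (hp.pos c hc).ne'
  obtain ⟨K, U, hU, hK⟩ := hc1.exists_lipschitzOnWith
  have hgc : ContinuousAt g c := hg.continuousAt (Ioi_mem_nhds hc.1)
  have hcT : ∀ᶠ t in 𝓝 c, t ∈ Ioo 1 T := Ioo_mem_nhds hc.1 hc.2
  have main : ∀ {f : ℝ → ℝ}, IsSol n g f T → f c = p c → ∀ᶠ t in 𝓝 c,
      HasDerivAt f (slopeRhs n (g t) t (f t) / (t ^ 2 - 1)) t ∧ f t ∈ {x | (g t, t, x) ∈ U} := by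
    intro f hf hfc
    have h1 : ContinuousAt (fun t => (g t, t, f t)) c :=
      hgc.prodMk (continuousAt_id.prodMk (hf.hasDerivAt c hc).continuousAt)
    have h2 : ∀ᶠ t in 𝓝 c, (g t, t, f t) ∈ U := by
      refine h1.eventually ?_
      simp only [hfc]
      exact hU
    filter_upwards [hcT, h2] with t ht ht'
    exact ⟨hf.hasDerivAt t ht, ht'⟩
  refine ODE_solution_unique_of_eventually (K := K) (s := fun t => {x | (g t, t, x) ∈ U})
    (v := fun t x => slopeRhs n (g t) t x / (t ^ 2 - 1)) (Eventually.of_forall fun t => ?_)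
    (main hp rfl) (main hq h.symm) h
  intro x hx y hy
  have := hK hx hy
  simpa [Prod.edist_eq] using this

/-- Near the pole two solutions approach each other as `c` grows, and they have the same limit at
the pole. -/
theorem IsSol.eq_near_one (hn : 0 < n) (hg1 : 0 < g 1) (hgc : ∀ᶠ c in 𝓝[>] 1, g c = g 1)
    (hT : 1 < T) (hp : IsSol n g p T) (hq : IsSol n g q T) : ∃ c ∈ Ioo 1 T, p c = q c := by
  obtain ⟨U, hU, hneg⟩ := eventually_slopeRhs_sub_mul_nonpos hn hg1
  have hmem : ∀ {f : ℝ → ℝ}, IsSol n g f T → ∀ᶠ c in 𝓝[>] 1, (c, f c) ∈ U := by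
    intro f hf
    have h1 : Tendsto (fun c : ℝ => (c, f c)) (𝓝[>] 1) (𝓝 (1, g 1 - 1)) :=
      (tendsto_nhdsWithin_of_tendsto_nhds tendsto_id).prodMk_nhds hf.tendsto
    exact h1.eventually hU
  have hT' : ∀ᶠ c in 𝓝[>] (1 : ℝ), c ∈ Ioo 1 T := Ioo_mem_nhdsGT hT
  obtain ⟨b, hb, hb'⟩ := mem_nhdsGT_iff_exists_Ioo_subset.1
    ((hmem hp).and ((hmem hq).and (hgc.and hT')))
  have hder : ∀ c ∈ Ioo 1 b, HasDerivAt (fun c => (p c - q c) ^ 2)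
      (2 * ((p c - q c) * (slopeRhs n (g c) c (p c) - slopeRhs n (g c) c (q c))) / (c ^ 2 - 1))
      c := by
    intro c hc
    have h := (hb' hc).2.2.2
    refine (((hp.hasDerivAt c h).sub (hq.hasDerivAt c h)).pow 2).congr_deriv ?_
    simp only [Pi.sub_apply]
    ring
  have hanti : AntitoneOn (fun c => (p c - q c) ^ 2) (Ioo 1 b) := by
    refine antitoneOn_of_deriv_nonpos (convex_Ioo 1 b)
      (fun c hc => (hder c hc).continuousAt.continuousWithinAt) ?_ ?_
    · rw [interior_Ioo]
      exact fun c hc => (hder c hc).differentiableAt.differentiableWithinAt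
    · rw [interior_Ioo]
      intro c hc
      rw [(hder c hc).deriv, (hb' hc).2.2.1]
      refine div_nonpos_of_nonpos_of_nonneg ?_ (sq_sub_one_pos hc.1).le
      linarith [hneg c (p c) (q c) (hb' hc).1 (hb' hc).2.1]
  have hb1 : (1 : ℝ) < b := hb
  set c := (1 + b) / 2 with hcdef
  have hc : c ∈ Ioo 1 b := ⟨by linarith, by linarith⟩
  refine ⟨c, (hb' hc).2.2.2, ?_⟩
  have hlim : Tendsto (fun c => (p c - q c) ^ 2) (𝓝[>] 1) (𝓝 0) := by
    simpa using (hp.tendsto.sub hq.tendsto).pow 2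
  have h0 : (p c - q c) ^ 2 ≤ 0 := by
    refine ge_of_tendsto hlim ?_
    filter_upwards [Ioo_mem_nhdsGT hc.1] with t ht
    exact hanti ⟨ht.1, ht.2.trans hc.2⟩ hc ht.2.le
  have h1 : p c - q c = 0 := by
    have := le_antisymm h0 (sq_nonneg _)
    exact pow_eq_zero_iff (two_ne_zero) |>.1 this
  linarith

theorem IsSol.eqOn (hn : 0 < n) (hg : ContinuousOn g (Ioi 1)) (hg1 : 0 < g 1)
    (hgc : ∀ᶠ c in 𝓝[>] 1, g c = g 1) (hp : IsSol n g p T) (hq : IsSol n g q T) :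
    EqOn p q (Ioo 1 T) := by
  rcases le_or_gt T 1 with hT | hT
  · intro c hc
    exact absurd (hc.1.trans hc.2) (not_lt.2 hT)
  obtain ⟨c₀, hc₀, h₀⟩ := hp.eq_near_one hn hg1 hgc hT hq
  have hsub : Ioo 1 T ⊆ {c | p =ᶠ[𝓝 c] q} := by
    refine isPreconnected_Ioo.subset_of_closure_inter_subset isOpen_setOfPred_eventually_nhds
      ⟨c₀, hc₀, hp.eventuallyEq_of_eq hg hq hc₀ h₀⟩ ?_
    rintro c ⟨hc, hcT⟩
    refine hp.eventuallyEq_of_eq hg hq hcT ?_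
    have hcont : ContinuousAt (fun t => p t - q t) c :=
      (hp.hasDerivAt c hcT).continuousAt.sub (hq.hasDerivAt c hcT).continuousAt
    have h1 : ∃ᶠ t in 𝓝 c, p t - q t = 0 := by
      refine (mem_closure_iff_frequently.1 hc).mono fun t ht => ?_
      have : p t = q t := EventuallyEq.eq_of_nhds ht
      rw [this, sub_self]
    have h2 : p c - q c ∈ ({0} : Set ℝ) :=
      isClosed_singleton.mem_of_frequently_of_tendsto h1 hcont.tendsto
    exact sub_eq_zero.1 h2
  exact fun c hc => EventuallyEq.eq_of_nhds (hsub hc)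

/-! ### Solutions near the pole -/

/-- At the pole the slope equation is a Briot–Bouquet equation in `t = c - 1`. Its holomorphic
solution restricts to a smooth solution on both sides of the pole. -/
theorem exists_contDiffAt_near_one {η : ℝ} (hn : 2 ≤ n) (hη : 0 < η) :
    ∃ δ > 0, ∃ p : ℝ → ℝ, p 1 = η - 1 ∧ ∀ c, |c - 1| < δ →
      ContDiffAt ℝ 4 p c ∧ (c ^ 2 - 1) * deriv p c = slopeRhs n η c (p c) := by
  have hη' : (η : ℂ) ≠ 0 := by exact_mod_cast hη.ne'
  let H : ℂ × ℂ → ℂ := fun y => slopeRhs (n : ℂ) η (1 + y.1) y.2 / (y.1 + 2) + (n / 2 : ℝ) * y.2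
  have hx : (1 : ℂ) + ((η - 1 : ℝ) : ℂ) * (1 + 0) ≠ 0 := by push_cast; simpa using hη'
  have hH : ContDiffAt ℂ 1 H (0, ((η - 1 : ℝ) : ℂ)) := by
    have h1 : ContDiffAt ℂ 1 (fun y : ℂ × ℂ => slopeRhs (n : ℂ) η (1 + y.1) y.2)
        (0, ((η - 1 : ℝ) : ℂ)) :=
      ContDiffAt.comp (f := fun y : ℂ × ℂ => ((η : ℂ), 1 + y.1, y.2)) (0, ((η - 1 : ℝ) : ℂ))
        (contDiffAt_slopeRhs (x := ((η : ℂ), 1 + 0, ((η - 1 : ℝ) : ℂ))) (n : ℂ) hx) (by fun_prop)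
    exact (h1.div (by fun_prop) (by simp)).add (by fun_prop)
  have h0 : H (0, ((η - 1 : ℝ) : ℂ)) = (n / 2 : ℝ) * ((η - 1 : ℝ) : ℂ) := by
    have := slopeRhs_one_self (n : ℂ) hη'
    simp only [H, add_zero]
    push_cast
    rw [this]
    simp
  have hd : HasDerivAt (fun q => H (0, q)) 0 ((η - 1 : ℝ) : ℂ) := by
    have h1 := hasDerivAt_slopeRhs_one (n : ℂ) hη'
    have h2 := (h1.div_const 2).add ((hasDerivAt_id ((η : ℂ) - 1)).const_mul ((n / 2 : ℝ) : ℂ))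
    push_cast at h2 ⊢
    simp only [H, add_zero, zero_add]
    refine (h2.congr_deriv (by ring)).congr_of_eventuallyEq (Eventually.of_forall fun q => ?_)
    simp
  have hreal : ∀ x y : ℝ, ∃ r : ℝ, H (x, y) = r := fun x y =>
    ⟨slopeRhs n η (1 + x) y / (x + 2) + n / 2 * y, by simp [H, ofReal_slopeRhs]⟩
  obtain ⟨δ, hδ, u, hu, hu0, hur, hueq⟩ :=
    BriotBouquet.exists_solution (by linarith : (1 : ℝ) ≤ n / 2) hH h0 hd hreal
  refine ⟨min δ 1, lt_min hδ one_pos, fun c => (u ((c - 1 : ℝ) : ℂ)).re, by simp [hu0],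
    fun c hc => ?_⟩
  have hcδ : |c - 1| < δ := hc.trans_le (min_le_left _ _)
  have hc2 : -1 < c - 1 := (abs_lt.1 (hc.trans_le (min_le_right _ _))).1
  have hmem : ((c - 1 : ℝ) : ℂ) ∈ Metric.ball (0 : ℂ) δ := by
    rw [mem_ball_zero_iff, Complex.norm_real]
    exact hcδ
  have han : AnalyticAt ℂ u ((c - 1 : ℝ) : ℂ) :=
    hu.analyticAt (Metric.isOpen_ball.mem_nhds hmem)
  constructor
  · have h1 : ContDiffAt ℝ 4 u ((c - 1 : ℝ) : ℂ) := han.contDiffAt.restrict_scalars ℝ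
    have h2 : ContDiffAt ℝ 4 (fun c : ℝ => ((c - 1 : ℝ) : ℂ)) c :=
      Complex.ofRealCLM.contDiff.contDiffAt.comp c (contDiffAt_id.sub contDiffAt_const)
    exact Complex.reCLM.contDiff.contDiffAt.comp c (h1.comp c h2)
  · have h1 : HasDerivAt (fun x : ℝ => (u x).re) (deriv u ((c - 1 : ℝ) : ℂ)).re (c - 1) :=
      han.differentiableAt.hasDerivAt.real_of_complex
    have h2 : HasDerivAt (fun c : ℝ => (u ((c - 1 : ℝ) : ℂ)).re)
        (deriv u ((c - 1 : ℝ) : ℂ)).re c := by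
      exact (h1.comp c ((hasDerivAt_id c).sub_const 1)).congr_deriv (mul_one _)
    rw [h2.deriv]
    obtain ⟨r, hr⟩ := hur (c - 1) hcδ
    have h3 := congrArg Complex.re (hueq _ hmem)
    have h4 : H (((c - 1 : ℝ) : ℂ), u ((c - 1 : ℝ) : ℂ)) =
        ((slopeRhs n η c r / (c + 1) + n / 2 * r : ℝ) : ℂ) := by
      have e1 : (1 : ℂ) + ((c - 1 : ℝ) : ℂ) = (c : ℂ) := by push_cast; ring
      have e2 : ((c - 1 : ℝ) : ℂ) + 2 = (c : ℂ) + 1 := by push_cast; ring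
      simp only [H, hr, e1, e2]
      push_cast [ofReal_slopeRhs]
      rfl
    rw [h4, hr] at h3
    simp only [hr]
    simp only [Complex.add_re, Complex.re_ofReal_mul, Complex.ofReal_re] at h3 ⊢
    have h5 : c + 1 ≠ 0 := by linarith
    have h6 : (c - 1) * (deriv u ((c - 1 : ℝ) : ℂ)).re = slopeRhs n η c r / (c + 1) := by
      linarith
    rw [eq_div_iff h5] at h6
    rw [← h6]
    ring

/-- A solution near the pole, smooth across the pole. -/
theorem exists_isSol_near_one (hn : 2 ≤ n) (hg1 : 0 < g 1)
    (hgc : ∀ᶠ c in 𝓝[>] 1, g c = g 1) :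
    ∃ δ > 0, ∃ p : ℝ → ℝ, p 1 = g 1 - 1 ∧ (∀ c, |c - 1| < δ → ContDiffAt ℝ 4 p c) ∧
      IsSol n g p (1 + δ) := by
  obtain ⟨δ, hδ, p, hp1, hp⟩ := exists_contDiffAt_near_one hn hg1
  have hcont : ContinuousAt p 1 := (hp 1 (by simpa using hδ)).1.continuousAt
  have e1 : ∀ᶠ c in 𝓝[>] (1 : ℝ), 0 < 1 - p c ^ 2 * (c ^ 2 - 1) := by
    have : ContinuousAt (fun c => 1 - p c ^ 2 * (c ^ 2 - 1)) 1 := by fun_prop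
    exact nhdsWithin_le_nhds (this.eventually_const_lt (by simp))
  have e2 : ∀ᶠ c in 𝓝[>] (1 : ℝ), 0 < 1 + p c * c := by
    have : ContinuousAt (fun c => 1 + p c * c) 1 := by fun_prop
    exact nhdsWithin_le_nhds (this.eventually_const_lt (by simpa [hp1] using hg1))
  obtain ⟨b, hb, hb'⟩ := mem_nhdsGT_iff_exists_Ioo_subset.1 (e1.and (e2.and hgc))
  have hb1 : (1 : ℝ) < b := hb
  have hmin : 0 < min δ (b - 1) := lt_min hδ (by linarith)
  have hsub : ∀ c ∈ Ioo 1 (1 + min δ (b - 1)), c ∈ Ioo 1 b := fun c hc =>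
    ⟨hc.1, hc.2.trans_le (by linarith [min_le_right δ (b - 1)])⟩
  refine ⟨min δ (b - 1), hmin, p, hp1, fun c hc => (hp c (hc.trans_le (min_le_left _ _))).1,
    fun c hc => (hb' (hsub c hc)).1, fun c hc => (hb' (hsub c hc)).2.1, fun c hc => ?_, ?_⟩
  · have hcδ : |c - 1| < δ := by
      rw [abs_of_pos (by linarith [hc.1])]
      linarith [hc.2, min_le_left δ (b - 1)]
    obtain ⟨h1, h2⟩ := hp c hcδ
    have h3 := (h1.differentiableAt (by simp)).hasDerivAt
    rwa [← mul_div_cancel_left₀ (deriv p c) (sq_sub_one_pos hc.1).ne', h2,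
      ← (hb' (hsub c hc)).2.2] at h3
  · rw [← hp1]
    exact hcont.tendsto.mono_left nhdsWithin_le_nhds

/-! ### Barriers and continuation -/

/-- An ordinary differential equation whose state variable is clamped to a continuously varying
interval, on which the field is `C¹`, is globally Lipschitz and has solutions on the whole time
interval. -/
theorem exists_clamped_solution {Φ : ℝ × ℝ × ℝ → ℝ} {lo hi : ℝ → ℝ} {a b : ℝ} (hab : a ≤ b)
    (hg : ContinuousOn g (Icc a b)) (hlo : ContinuousOn lo (Icc a b))
    (hhi : ContinuousOn hi (Icc a b)) (hlt : ∀ t ∈ Icc a b, lo t < hi t)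
    (hΦ : ∀ t ∈ Icc a b, ∀ x ∈ Icc (lo t) (hi t), ContDiffAt ℝ 1 Φ (g t, t, x)) (x₀ : ℝ) :
    ∃ K : ℝ≥0, (∀ t ∈ Icc a b, LipschitzWith K fun x => Φ (g t, t, max (lo t) (min x (hi t)))) ∧
      ∃ p : ℝ → ℝ, p a = x₀ ∧ ∀ t ∈ Icc a b,
        HasDerivWithinAt p (Φ (g t, t, max (lo t) (min (p t) (hi t)))) (Icc a b) t := by
  have hclamp : ∀ t ∈ Icc a b, ∀ x, max (lo t) (min x (hi t)) ∈ Icc (lo t) (hi t) := fun t ht x =>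
    ⟨le_max_left _ _, max_le (hlt t ht).le (min_le_right _ _)⟩
  let D : Set (ℝ × ℝ × ℝ) := (fun q : ℝ × ℝ => (g q.1, q.1, lo q.1 + q.2 * (hi q.1 - lo q.1))) ''
    (Icc a b ×ˢ Icc 0 1)
  have hD : IsCompact D := by
    refine (isCompact_Icc.prod isCompact_Icc).image_of_continuousOn ?_
    have h1 : ∀ {f : ℝ → ℝ}, ContinuousOn f (Icc a b) →
        ContinuousOn (fun q : ℝ × ℝ => f q.1) (Icc a b ×ˢ Icc 0 1) := fun hf =>
      hf.comp continuousOn_fst fun q hq => hq.1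
    exact (h1 hg).prodMk (continuousOn_fst.prodMk ((h1 hlo).add
      (continuousOn_snd.mul ((h1 hhi).sub (h1 hlo)))))
  have hmem : ∀ t ∈ Icc a b, ∀ x ∈ Icc (lo t) (hi t), (g t, t, x) ∈ D := by
    intro t ht x hx
    have h0 : 0 < hi t - lo t := sub_pos.2 (hlt t ht)
    refine ⟨(t, (x - lo t) / (hi t - lo t)), ⟨ht, div_nonneg (by linarith [hx.1]) h0.le,
      (div_le_one h0).2 (by linarith [hx.2])⟩, ?_⟩
    simp only [div_mul_cancel₀ _ h0.ne', add_sub_cancel]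
  have hΦD : ∀ y ∈ D, ContDiffAt ℝ 1 Φ y := by
    rintro _ ⟨⟨t, s⟩, ⟨ht, hs0, hs1⟩, rfl⟩
    have h0 : 0 < hi t - lo t := sub_pos.2 (hlt t ht)
    simp only at hs0 hs1
    refine hΦ t ht _ ⟨?_, ?_⟩
    · simp only; nlinarith
    · simp only; nlinarith
  obtain ⟨L, hL⟩ := hD.exists_bound_of_continuousOn
    fun y hy => (hΦD y hy).continuousAt.continuousWithinAt
  obtain ⟨K, hK⟩ := hD.exists_bound_of_continuousOn
    fun y hy => ((hΦD y hy).continuousAt_fderiv one_ne_zero).continuousWithinAt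
  have hlip : ∀ t ∈ Icc a b, LipschitzOnWith K.toNNReal (fun x => Φ (g t, t, x))
      (Icc (lo t) (hi t)) := by
    intro t ht
    refine Convex.lipschitzOnWith_of_nnnorm_hasDerivWithin_le (convex_Icc _ _)
      (f' := fun x => fderiv ℝ Φ (g t, t, x) (0, 0, 1)) (fun x hx => ?_) fun x hx => ?_
    · have h1 : HasDerivAt (fun x : ℝ => (g t, t, x)) (0, 0, 1) x :=
        (hasDerivAt_const _ _).prodMk ((hasDerivAt_const _ _).prodMk (hasDerivAt_id _))
      exact (((hΦ t ht x hx).differentiableAt one_ne_zero).hasFDerivAt.comp_hasDerivAt x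
        h1).hasDerivWithinAt
    · have h1 := hK _ (hmem t ht x hx)
      have h2 := (fderiv ℝ Φ (g t, t, x)).le_opNorm (0, 0, 1)
      have h3 : ‖((0 : ℝ), (0 : ℝ), (1 : ℝ))‖ = 1 := by simp [Prod.norm_def]
      rw [h3, mul_one] at h2
      rw [← NNReal.coe_le_coe, coe_nnnorm]
      exact (h2.trans h1).trans (Real.le_coe_toNNReal K)
  have hlip' : ∀ t ∈ Icc a b,
      LipschitzWith K.toNNReal fun x => Φ (g t, t, max (lo t) (min x (hi t))) := by
    intro t ht
    have h1 : LipschitzWith 1 fun x => max (lo t) (min x (hi t)) :=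
      (LipschitzWith.id.min_const _).const_max _
    have h2 := (hlip t ht).comp (h1.lipschitzOnWith (s := univ)) fun x _ => hclamp t ht x
    rw [mul_one, lipschitzOnWith_univ] at h2
    exact h2
  refine ⟨K.toNNReal, hlip', ?_⟩
  have hL0 : 0 ≤ L := (norm_nonneg _).trans
    (hL _ (hmem a (left_mem_Icc.2 hab) _ (left_mem_Icc.2 (hlt a (left_mem_Icc.2 hab)).le)))
  have hP : IsPicardLindelof (fun t x => Φ (g t, t, max (lo t) (min x (hi t))))
      (⟨a, left_mem_Icc.2 hab⟩ : Icc a b) x₀ (L.toNNReal * (b - a).toNNReal) 0 L.toNNReal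
      K.toNNReal := by
    refine ⟨fun t ht => (hlip' t ht).lipschitzOnWith, fun x _ t ht => ?_, fun t ht x _ => ?_, ?_⟩
    · have h1 : ContinuousWithinAt (fun t => (g t, t, max (lo t) (min x (hi t)))) (Icc a b) t :=
        (hg t ht).prodMk (continuousWithinAt_id.prodMk
          ((hlo t ht).max (continuousWithinAt_const.min (hhi t ht))))
      exact (hΦ t ht _ (hclamp t ht x)).continuousAt.comp_continuousWithinAt
        (f := fun t => (g t, t, max (lo t) (min x (hi t)))) h1
    · exact (hL _ (hmem t ht _ (hclamp t ht x))).trans (Real.le_coe_toNNReal L)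
    · simp [Real.coe_toNNReal _ hL0, hab]
  exact hP.exists_eq_forall_mem_Icc_hasDerivWithinAt₀

/-- Away from the pole every admissible initial slope is continued to an admissible solution of any
length. The lower barrier is `-(1 - m) / c` with `m` small, where the equation pushes upwards; the
upper barrier `1 / √(c² - 1)`, the slope of a light cone, is itself a solution and is not reached
because solutions do not cross. -/
theorem exists_extension {c₀ p₀ : ℝ} (hn : 2 ≤ n) (hc₀ : 1 < c₀) (hT : c₀ < T)
    (hg : ContinuousOn g (Icc c₀ T)) (hgpos : ∀ c ∈ Icc c₀ T, 0 < g c)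
    (hw : 0 < 1 - p₀ ^ 2 * (c₀ ^ 2 - 1)) (hb : 0 < 1 + p₀ * c₀) :
    ∃ p : ℝ → ℝ, p c₀ = p₀ ∧ ∀ c ∈ Icc c₀ T, 0 < 1 - p c ^ 2 * (c ^ 2 - 1) ∧ 0 < 1 + p c * c ∧
      HasDerivWithinAt p (slopeRhs n (g c) c (p c) / (c ^ 2 - 1)) (Icc c₀ T) c := by
  have hcI : ∀ {c}, c ∈ Icc c₀ T → 1 < c := fun hc => hc₀.trans_le hc.1
  obtain ⟨G, hG, hgG⟩ : ∃ G > 0, ∀ c ∈ Icc c₀ T, G ≤ g c := by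
    obtain ⟨c, hc, hmin⟩ := isCompact_Icc.exists_isMinOn (nonempty_Icc.2 hT.le) hg
    exact ⟨g c, hgpos c hc, fun t ht => hmin ht⟩
  have hT1 : 1 < T := hc₀.trans hT
  obtain ⟨m, hm, hm'⟩ : ∃ m > 0, m < min (1 + p₀ * c₀) (min 1 (G ^ 2 / (T ^ 2 * (T ^ 2 + 1)))) :=
    exists_between (lt_min hb (lt_min one_pos (by positivity)))
  have hmb : m < 1 + p₀ * c₀ := hm'.trans_le (min_le_left _ _)
  have hm1 : m < 1 := hm'.trans_le ((min_le_right _ _).trans (min_le_left _ _))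
  have hmG : m * (T ^ 2 * (T ^ 2 + 1)) < G ^ 2 := by
    rw [← lt_div_iff₀ (by positivity)]
    exact hm'.trans_le ((min_le_right _ _).trans (min_le_right _ _))
  let lo : ℝ → ℝ := fun c => -(1 - m) / c
  let hi : ℝ → ℝ := fun c => 1 / √(c ^ 2 - 1)
  have hloc : ∀ {c}, c ∈ Icc c₀ T → lo c * c = -(1 - m) := fun hc =>
    div_mul_cancel₀ _ (by linarith [hcI hc])
  have hsq : ∀ {c}, c ∈ Icc c₀ T → 0 < √(c ^ 2 - 1) := fun hc =>
    Real.sqrt_pos.2 (sq_sub_one_pos (hcI hc))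
  have hhi0 : ∀ {c}, c ∈ Icc c₀ T → 0 < hi c := fun hc => one_div_pos.2 (hsq hc)
  have hhi2 : ∀ {c}, c ∈ Icc c₀ T → hi c ^ 2 * (c ^ 2 - 1) = 1 := by
    intro c hc
    have := sq_sub_one_pos (hcI hc)
    simp only [hi, div_pow, Real.sq_sqrt this.le]
    field_simp
  have hlod : ∀ {c}, c ∈ Icc c₀ T → HasDerivAt lo ((1 - m) / c ^ 2) c := by
    intro c hc
    have hc0 : c ≠ 0 := by linarith [hcI hc]
    refine ((hasDerivAt_const c (-(1 - m))).div (hasDerivAt_id c) hc0).congr_deriv ?_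
    simp
  have hhid : ∀ {c}, c ∈ Icc c₀ T → HasDerivAt hi (-(c * hi c ^ 3)) c := by
    intro c hc
    have h0 := hsq hc
    have h1 : HasDerivAt (fun c : ℝ => c ^ 2 - 1) (2 * c) c := by
      simpa using (hasDerivAt_pow 2 c).sub_const 1
    have h2 := (hasDerivAt_const c (1 : ℝ)).div (h1.sqrt (sq_sub_one_pos (hcI hc)).ne') h0.ne'
    refine h2.congr_deriv ?_
    simp only [hi]
    field_simp
    ring
  have hlt : ∀ c ∈ Icc c₀ T, lo c < hi c := fun c hc =>
    (div_neg_of_neg_of_pos (by linarith) (by linarith [hcI hc])).trans (hhi0 hc)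
  obtain ⟨K, hK, p, hp0, hp⟩ := exists_clamped_solution hT.le hg
    (fun c hc => (hlod hc).continuousAt.continuousWithinAt)
    (fun c hc => (hhid hc).continuousAt.continuousWithinAt) hlt
    (Φ := fun y => slopeRhs n y.1 y.2.1 y.2.2 / (y.2.1 ^ 2 - 1))
    (fun c hc x hx => contDiffAt_slopeField n (hcI hc) (by
      have h1 : lo c * c ≤ x * c := mul_le_mul_of_nonneg_right hx.1 (by linarith [hcI hc])
      rw [hloc hc] at h1
      simp only
      linarith)) p₀
  have hpc : ContinuousOn p (Icc c₀ T) := fun c hc => (hp c hc).continuousWithinAt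
  have hl0 : c₀ ∈ Icc c₀ T := left_mem_Icc.2 hT.le
  -- The lower barrier.
  have hlow : ∀ c ∈ Icc c₀ T, lo c ≤ p c := by
    refine image_le_of_deriv_right_lt_deriv_boundary' (f' := fun c => (1 - m) / c ^ 2)
      (fun c hc => (hlod hc).continuousAt.continuousWithinAt)
      (fun c hc => (hlod (Ico_subset_Icc_self hc)).hasDerivWithinAt) ?_ hpc
      (fun c hc => (hp c (Ico_subset_Icc_self hc)).mono_of_mem_nhdsWithin
        (Icc_mem_nhdsGE_of_mem hc)) ?_
    · rw [hp0]
      refine (div_le_iff₀ (by linarith)).2 ?_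
      linarith
    · intro c hc heq
      replace hc := Ico_subset_Icc_self hc
      have hc1 := hcI hc
      have hs := sq_sub_one_pos hc1
      rw [← heq, min_eq_left (hlt c hc).le, max_self]
      simp only
      rw [lt_div_iff₀ hs, slopeRhs, hloc hc]
      have hcT : c ^ 2 ≤ T ^ 2 := by nlinarith [hc.2]
      have hlo2 : lo c ^ 2 * c ^ 2 = (1 - m) ^ 2 := by
        rw [← mul_pow, hloc hc]; ring
      have hc2 : 0 < c ^ 2 := by positivity
      set w := 1 - lo c ^ 2 * (c ^ 2 - 1) with hwdef
      have hwc : 1 ≤ w * c ^ 2 := by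
        have : w * c ^ 2 = c ^ 2 - (1 - m) ^ 2 * (c ^ 2 - 1) := by
          rw [hwdef, ← hlo2]; ring
        rw [this]
        nlinarith [mul_nonneg hm.le (by linarith : (0 : ℝ) ≤ 2 - m)]
      have hw0 : 0 < w := by
        by_contra h
        nlinarith
      have hw1 : 1 / c ^ 2 ≤ w := (div_le_iff₀ hc2).2 hwc
      -- Here `g² w / m` exceeds `c²`, by the choice of `m`.
      have hq : c ^ 2 + m ≤ g c ^ 2 * w / (1 + -(1 - m)) := by
        have e : 1 + -(1 - m) = m := by ring
        rw [e, le_div_iff₀ hm]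
        have h1 : G ^ 2 ≤ g c ^ 2 := pow_le_pow_left₀ hG.le (hgG c hc) 2
        have h2 : G ^ 2 / T ^ 2 ≤ g c ^ 2 * w := by
          calc G ^ 2 / T ^ 2 ≤ g c ^ 2 / c ^ 2 := by gcongr
            _ = g c ^ 2 * (1 / c ^ 2) := by ring
            _ ≤ _ := by gcongr
        have h3 : m * (T ^ 2 + 1) ≤ G ^ 2 / T ^ 2 := by
          rw [le_div_iff₀ (by positivity)]
          linarith
        nlinarith
      have h4 : 1 ≤ n / 2 * w * (g c ^ 2 * w / (1 + -(1 - m)) - (1 + -(1 - m))) := by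
        have h5 : c ^ 2 ≤ g c ^ 2 * w / (1 + -(1 - m)) - (1 + -(1 - m)) := by linarith
        calc (1 : ℝ) ≤ w * c ^ 2 := hwc
          _ ≤ n / 2 * w * c ^ 2 := by nlinarith [mul_nonneg hw0.le hc2.le]
          _ ≤ _ := mul_le_mul_of_nonneg_left h5 (by positivity)
      have h6 : c * lo c ^ 3 * (c ^ 2 - 1) ≤ 0 := by
        have : c * lo c ^ 3 = -(1 - m) * lo c ^ 2 := by rw [← hloc hc]; ring
        rw [this]
        have : 0 ≤ (1 - m) * lo c ^ 2 * (c ^ 2 - 1) :=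
          mul_nonneg (mul_nonneg (by linarith) (sq_nonneg _)) hs.le
        linarith
      have h7 : (1 - m) / c ^ 2 * (c ^ 2 - 1) < 1 := by
        rw [div_mul_eq_mul_div, div_lt_one hc2]
        nlinarith
      linarith
  -- The upper barrier.
  have hup : ∀ c ∈ Icc c₀ T, p c < hi c := by
    intro c₁ hc₁
    by_contra! hcon
    have h0 : p c₀ - hi c₀ < 0 := by
      rw [hp0, sub_neg]
      refine lt_of_pow_lt_pow_left₀ 2 (hhi0 hl0).le ?_
      have := hhi2 hl0
      have hs := sq_sub_one_pos hc₀
      nlinarith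
    have hsub : Icc c₀ c₁ ⊆ Icc c₀ T := Icc_subset_Icc_right hc₁.2
    have hcont : ContinuousOn (fun c => p c - hi c) (Icc c₀ c₁) := fun c hc =>
      ((hpc c (hsub hc)).mono hsub).sub (hhid (hsub hc)).continuousAt.continuousWithinAt
    obtain ⟨c₂, hc₂, h2⟩ := intermediate_value_Icc hc₁.1 hcont
      ⟨h0.le, sub_nonneg.2 hcon⟩
    have h2' : p c₂ = hi c₂ := sub_eq_zero.1 h2
    have hsub2 : Icc c₀ c₂ ⊆ Icc c₀ T := (Icc_subset_Icc_right hc₂.2).trans hsub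
    have heq := ODE_solution_unique_of_mem_Icc_left (a := c₀) (b := c₂) (K := K)
      (s := fun _ => univ) (f := p) (g := hi)
      (v := fun t x => slopeRhs n (g t) t (max (lo t) (min x (hi t))) / (t ^ 2 - 1))
      (fun t ht => (hK t (hsub2 (Ioc_subset_Icc_self ht))).lipschitzOnWith)
      (hpc.mono hsub2)
      (fun t ht => (hp t (hsub2 (Ioc_subset_Icc_self ht))).mono_of_mem_nhdsWithin
        (Icc_mem_nhdsLE_of_mem ⟨ht.1, ht.2.trans (hc₂.2.trans hc₁.2)⟩))
      (fun _ _ => mem_univ _)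
      (fun t ht => (hhid (hsub2 ht)).continuousAt.continuousWithinAt)
      (fun t ht => by
        have ht' := hsub2 (Ioc_subset_Icc_self ht)
        refine ((hhid ht').congr_deriv ?_).hasDerivWithinAt
        have hs := sq_sub_one_pos (hcI ht')
        simp only [min_self]
        rw [max_eq_right (hlt t ht').le, slopeRhs, hhi2 ht', eq_div_iff hs.ne']
        ring)
      (fun _ _ => mem_univ _) h2'
    have := heq (left_mem_Icc.2 hc₂.1)
    linarith
  refine ⟨p, hp0, fun c hc => ?_⟩
  have hc1 := hcI hc
  have hpos : 0 < 1 + p c * c := by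
    have h1 : lo c * c ≤ p c * c := mul_le_mul_of_nonneg_right (hlow c hc) (by linarith)
    rw [hloc hc] at h1
    linarith
  have hd := hp c hc
  rw [min_eq_left (hup c hc).le, max_eq_right (hlow c hc)] at hd
  refine ⟨?_, hpos, hd⟩
  rcases le_or_gt 0 (p c) with h | h
  · have h1 : p c ^ 2 < hi c ^ 2 := pow_lt_pow_left₀ (hup c hc) h two_ne_zero
    have := mul_lt_mul_of_pos_right h1 (sq_sub_one_pos hc1)
    rw [hhi2 hc] at this
    linarith
  · have h1 : (p c * c) ^ 2 < 1 := by
      have : p c * c < 0 := mul_neg_of_neg_of_pos h (by linarith)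
      nlinarith
    nlinarith [sq_nonneg (p c)]

/-! ### The global solution and its regularity -/

open HolderGerm

/-- The solution near the pole, joined to its continuation up to `T`. -/
theorem exists_isSol (hn : 2 ≤ n) (hg : ContinuousOn g (Ioi 1)) (hgpos : ∀ c, 1 ≤ c → 0 < g c)
    (hgc : ∀ᶠ c in 𝓝[>] 1, g c = g 1) (T : ℝ) : ∃ p, IsSol n g p T := by
  obtain ⟨δ, hδ, u, hu1, hu, hsol⟩ := exists_isSol_near_one hn (hgpos 1 le_rfl) hgc
  rcases le_or_gt T (1 + δ) with hT | hT
  · exact ⟨u, hsol.mono hT⟩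
  set c₀ := 1 + δ / 2 with hc₀def
  have hc₀ : 1 < c₀ := by linarith
  have hc₀T : c₀ < T := by linarith
  have hmem : c₀ ∈ Ioo 1 (1 + δ) := ⟨hc₀, by linarith⟩
  obtain ⟨q, hq0, hq⟩ := exists_extension hn hc₀ hc₀T
    (hg.mono fun c hc => hc₀.trans_le hc.1) (fun c hc => hgpos c (hc₀.le.trans hc.1))
    (hsol.spacelike c₀ hmem) (hsol.pos c₀ hmem)
  let p : ℝ → ℝ := fun c => if c ≤ c₀ then u c else q c
  have hpu : ∀ {c}, c ≤ c₀ → p c = u c := fun hc => if_pos hc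
  have hpq : ∀ {c}, c₀ ≤ c → p c = q c := fun {c} hc => by
    rcases hc.eq_or_lt with h | h
    · rw [← h, hpu le_rfl, hq0]
    · exact if_neg (not_le.2 h)
  have hside : ∀ {c}, c ∈ Ioo 1 T → c ≤ c₀ ∧ c ∈ Ioo 1 (1 + δ) ∨ c₀ ≤ c ∧ c ∈ Icc c₀ T := by
    intro c hc
    rcases le_total c c₀ with h | h
    · exact Or.inl ⟨h, hc.1, by linarith⟩
    · exact Or.inr ⟨h, h, hc.2.le⟩
  refine ⟨p, fun c hc => ?_, fun c hc => ?_, fun c hc => ?_, ?_⟩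
  · rcases hside hc with ⟨h, h'⟩ | ⟨h, h'⟩
    · rw [hpu h]; exact hsol.spacelike c h'
    · rw [hpq h]; exact (hq c h').1
  · rcases hside hc with ⟨h, h'⟩ | ⟨h, h'⟩
    · rw [hpu h]; exact hsol.pos c h'
    · rw [hpq h]; exact (hq c h').2.1
  · rcases lt_trichotomy c c₀ with h | h | h
    · rw [hpu h.le]
      refine (hsol.hasDerivAt c ⟨hc.1, by linarith⟩).congr_of_eventuallyEq ?_
      filter_upwards [Iio_mem_nhds h] with t ht using hpu (le_of_lt ht)
    · -- At the junction the two one-sided derivatives agree.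
      rw [h]
      have h1 : HasDerivWithinAt p (slopeRhs n (g c₀) c₀ (p c₀) / (c₀ ^ 2 - 1)) (Iic c₀) c₀ := by
        rw [hpu le_rfl]
        exact (hsol.hasDerivAt c₀ hmem).hasDerivWithinAt.congr (fun t ht => hpu ht) (hpu le_rfl)
      have h2 : HasDerivWithinAt p (slopeRhs n (g c₀) c₀ (p c₀) / (c₀ ^ 2 - 1)) (Ici c₀) c₀ := by
        rw [hpq le_rfl]
        have h3 := (hq c₀ ⟨le_rfl, hc₀T.le⟩).2.2.mono_of_mem_nhdsWithin
          (Icc_mem_nhdsGE_of_mem ⟨le_rfl, hc₀T⟩)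
        exact h3.congr (fun t ht => hpq ht) (hpq le_rfl)
      have h3 := h1.union h2
      rwa [Iic_union_Ici, hasDerivWithinAt_univ] at h3
    · rw [hpq h.le]
      refine ((hq c ⟨h.le, hc.2.le⟩).2.2.hasDerivAt (Icc_mem_nhds h hc.2)).congr_of_eventuallyEq ?_
      filter_upwards [Ioi_mem_nhds h] with t ht using hpq (le_of_lt ht)
  · refine hsol.tendsto.congr' ?_
    filter_upwards [Ioo_mem_nhdsGT hc₀] with t ht using (hpu ht.2.le).symm

/-- The slope of the solution: it solves the equation on `(1, ∞)` and is smooth across the pole. -/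
theorem exists_global_isSol (hn : 2 ≤ n) (hg : ContinuousOn g (Ioi 1))
    (hgpos : ∀ c, 1 ≤ c → 0 < g c) (hgc : ∀ᶠ c in 𝓝[>] 1, g c = g 1) :
    ∃ δ > 0, ∃ p : ℝ → ℝ, p 1 = g 1 - 1 ∧ (∀ c, |c - 1| < δ → ContDiffAt ℝ 4 p c) ∧
      ∀ T, IsSol n g p T := by
  have hn0 : 0 < n := by linarith
  have hg1 := hgpos 1 le_rfl
  obtain ⟨δ, hδ, u, hu1, hu, hsol⟩ := exists_isSol_near_one hn hg1 hgc
  choose s hs using exists_isSol hn hg hgpos hgc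
  let p : ℝ → ℝ := fun c => if c ≤ 1 then u c else s (c + 1) c
  have huniq : ∀ {f T}, IsSol n g f T → ∀ c ∈ Ioo 1 T, p c = f c := by
    intro f T hf c hc
    have h1 : p c = s (c + 1) c := if_neg (not_le.2 hc.1)
    rw [h1]
    exact IsSol.eqOn hn0 hg hg1 hgc ((hs (c + 1)).mono (min_le_left _ T))
      (hf.mono (min_le_right _ _)) ⟨hc.1, lt_min (lt_add_one c) hc.2⟩
  refine ⟨δ, hδ, p, ?_, fun c hc => ?_,
    fun T => ⟨fun c hc => ?_, fun c hc => ?_, fun c hc => ?_, ?_⟩⟩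
  · exact (if_pos le_rfl).trans hu1
  · refine (hu c hc).congr_of_eventuallyEq ?_
    have h1 : ∀ᶠ t in 𝓝 c, t < 1 + δ := Iio_mem_nhds (by linarith [(abs_lt.1 hc).2])
    filter_upwards [h1] with t ht
    rcases le_or_gt t 1 with h | h
    · exact if_pos h
    · exact huniq hsol t ⟨h, ht⟩
  · rw [huniq (hs T) c hc]; exact (hs T).spacelike c hc
  · rw [huniq (hs T) c hc]; exact (hs T).pos c hc
  · rw [huniq (hs T) c hc]
    refine ((hs T).hasDerivAt c hc).congr_of_eventuallyEq ?_
    filter_upwards [Ioo_mem_nhds hc.1 hc.2] with t ht using huniq (hs T) t ht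
  · refine hsol.tendsto.congr' ?_
    filter_upwards [Ioo_mem_nhdsGT (by linarith : 1 < 1 + δ)] with t ht using (huniq hsol t ht).symm

/-- Bootstrapping: the solution has one derivative more than the prescribed curvature. -/
theorem IsSol.ckHolderAt {α c : ℝ} (hα : 0 < α) (hα1 : α ≤ 1) (hp : IsSol n g p T)
    (hc : c ∈ Ioo 1 T) {k : ℕ} (hgk : CkHolderAt k α g c) (hg1 : ContDiffAt ℝ 1 g c) :
    CkHolderAt (k + 1) α p c := by
  let Φ : ℝ × ℝ × ℝ → ℝ := fun y => slopeRhs n y.1 y.2.1 y.2.2 / (y.2.1 ^ 2 - 1)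
  have hΦ : ∀ {m : WithTop ℕ∞}, ∀ t ∈ Ioo 1 T, ContDiffAt ℝ m Φ (g t, t, p t) := fun t ht =>
    contDiffAt_slopeField n ht.1 (hp.pos t ht).ne'
  have hev : ∀ᶠ t in 𝓝 c, t ∈ Ioo 1 T := Ioo_mem_nhds hc.1 hc.2
  have hder : ∀ᶠ t in 𝓝 c, HasDerivAt p (Φ (g t, t, p t)) t := hev.mono fun t ht =>
    hp.hasDerivAt t ht
  have hpC1 : ContDiffAt ℝ 1 p c := by
    have hgc : ∀ᶠ t in 𝓝 c, ContinuousAt g t := by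
      filter_upwards [hg1.eventually (by simp)] with t ht using ht.continuousAt
    refine contDiffAt_one_iff.2 ⟨fun t => ContinuousLinearMap.toSpanSingleton ℝ (Φ (g t, t, p t)),
      {t | t ∈ Ioo 1 T ∧ ContinuousAt g t}, hev.and hgc, ?_, fun t ht =>
        (hp.hasDerivAt t ht.1).hasFDerivAt⟩
    intro t ht
    refine ContinuousAt.continuousWithinAt ?_
    have h1 : ContinuousAt (fun t => (g t, t, p t)) t :=
      ht.2.prodMk (continuousAt_id.prodMk (hp.hasDerivAt t ht.1).continuousAt)
    have h2 : ContinuousAt (fun t => Φ (g t, t, p t)) t :=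
      ContinuousAt.comp (f := fun t => (g t, t, p t)) (hΦ (m := 1) t ht.1).continuousAt h1
    exact (ContinuousLinearMap.toSpanSingletonCLE (𝕜 := ℝ) (E := ℝ)).continuous.continuousAt.comp h2
  have hin : ContDiffAt ℝ 1 (fun t => (g t, t, p t)) c :=
    hg1.prodMk (contDiffAt_id.prodMk hpC1)
  have step : ∀ j, CkHolderAt j α g c → CkHolderAt j α p c → CkHolderAt (j + 1) α p c := by
    intro j hgj hpj
    refine CkHolderAt.of_hasDerivAt hder ?_
    exact CkHolderAt.comp hα hα1 (f := fun t => (g t, t, p t)) hin j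
      (.of_contDiffAt hα1 (hΦ c hc)) (hgj.prodMk
        (CkHolderAt.prodMk (.of_contDiffAt hα1 contDiffAt_id) hpj))
  have h0 : CkHolderAt 0 α p c := .of_contDiffAt hα1 (by simpa using hpC1)
  induction k with
  | zero => exact step 0 hgk h0
  | succ k ih => exact step (k + 1) hgk (ih (hgk.of_succ hα1))

/-- The profile `P` with `φ = P(cosh r)`: a primitive of the slope. -/
theorem exists_profile {α : ℝ} (hα : 0 < α) (hα1 : α ≤ 1) (hn : 2 ≤ n)
    (hg : ∀ c, 1 < c → CkHolderAt 2 α g c) (hgpos : ∀ c, 1 ≤ c → 0 < g c)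
    (hgc : ∀ᶠ c in 𝓝[>] 1, g c = g 1) (φ₀ : ℝ) :
    ∃ P p : ℝ → ℝ, P 1 = φ₀ ∧ (∀ c, 1 ≤ c → ∀ᶠ t in 𝓝 c, HasDerivAt P (p t) t) ∧
      (∀ c, 1 ≤ c → CkHolderAt 4 α P c) ∧ p 1 = g 1 - 1 ∧ DifferentiableAt ℝ p 1 ∧
      ∀ T, IsSol n g p T := by
  have hgcont : ContinuousOn g (Ioi 1) := fun c hc => (hg c hc).1.continuousAt.continuousWithinAt
  obtain ⟨δ, hδ, p, hp1, hpδ, hp⟩ := exists_global_isSol hn hgcont hgpos hgc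
  have hp3 : ∀ c, 1 - δ < c → CkHolderAt 3 α p c := by
    intro c hc
    rcases lt_or_ge c (1 + δ) with h | h
    · have h1 : |c - 1| < δ := abs_lt.2 ⟨by linarith, by linarith⟩
      exact .of_contDiffAt hα1 (by
        have := hpδ c h1
        norm_num
        exact this)
    · have h1 : 1 < c := by linarith
      exact (hp (c + 1)).ckHolderAt hα hα1 ⟨h1, lt_add_one c⟩ (hg c h1)
        ((hg c h1).1.of_le (by norm_num))
  have hcont : ContinuousOn p (Ioi (1 - δ)) := fun c hc =>
    (hp3 c hc).1.continuousAt.continuousWithinAt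
  have hder : ∀ c, 1 - δ < c → HasDerivAt (fun c => φ₀ + ∫ t in (1 : ℝ)..c, p t) (p c) c := by
    intro c hc
    refine (intervalIntegral.integral_hasDerivAt_right ?_ ?_ ?_).const_add φ₀
    · refine (hcont.mono fun t ht => ?_).intervalIntegrable
      exact (lt_min (by linarith) hc).trans_le ht.1
    · exact hcont.stronglyMeasurableAtFilter isOpen_Ioi c hc
    · exact hcont.continuousAt (Ioi_mem_nhds hc)
  have hev : ∀ c, 1 ≤ c →
      ∀ᶠ t in 𝓝 c, HasDerivAt (fun c => φ₀ + ∫ t in (1 : ℝ)..c, p t) (p t) t := by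
    intro c hc
    filter_upwards [Ioi_mem_nhds (by linarith : 1 - δ < c)] with t ht using hder t ht
  exact ⟨_, p, by simp, hev, fun c hc => .of_hasDerivAt (hev c hc) (hp3 c (by linarith)), hp1,
    (hpδ 1 (by simpa using hδ)).differentiableAt (by simp), hp⟩

end SlopeODE

/-! ### Rank-one perturbations of scalar endomorphisms -/

namespace RadialGraph

open Polynomial in
theorem charpoly_smul_one_add_smulRight {V : Type} [AddCommGroup V] [Module ℝ V]
    [FiniteDimensional ℝ V] (β : ℝ) (f : V →ₗ[ℝ] ℝ) (z : V) (hV : 1 ≤ Module.finrank ℝ V) :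
    (β • (1 : Module.End ℝ V) + f.smulRight z).charpoly =
      (X - C (β + f z)) * (X - C β) ^ (Module.finrank ℝ V - 1) := by
  have h1 : (f.smulRight z).charpoly =
      X ^ Module.finrank ℝ V - C (f z) * X ^ (Module.finrank ℝ V - 1) := by
    have b := Module.finBasis ℝ V
    have e : LinearMap.toMatrix b b (f.smulRight z) =
        Matrix.vecMulVec (fun i => b.repr z i) fun j => f (b j) := by
      ext i j
      simp [LinearMap.toMatrix_apply, Matrix.vecMulVec_apply, mul_comm]
    have e2 : (fun i => b.repr z i) ⬝ᵥ (fun j => f (b j)) = f z := by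
      conv_rhs => rw [← b.sum_repr z, map_sum]
      simp [dotProduct]
    rw [← LinearMap.charpoly_toMatrix _ b, e, Matrix.charpoly_vecMulVec, e2, Fintype.card_fin,
      smul_eq_C_mul]
  have h2 : β • (1 : Module.End ℝ V) + f.smulRight z = f.smulRight z - (-β) • 1 := by
    rw [neg_smul, sub_neg_eq_add, add_comm]
  obtain ⟨k, hk⟩ := Nat.exists_eq_add_of_le' hV
  rw [h2, LinearMap.charpoly_sub_smul, h1, hk]
  simp only [sub_comp, pow_comp, X_comp, mul_comp, C_comp, add_tsub_cancel_right, map_neg, C_add]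
  ring

theorem esymm_one_eq_sum (s : Multiset ℝ) : s.esymm 1 = s.sum := by
  simp [Multiset.esymm, Multiset.powersetCard_one]

theorem esymm_two_cons (a : ℝ) (s : Multiset ℝ) :
    (a ::ₘ s).esymm 2 = s.esymm 2 + a * s.sum := by
  rw [← esymm_one_eq_sum s]
  simp [Multiset.esymm, Multiset.powersetCard_cons, Multiset.sum_map_mul_left]

theorem esymm_two_replicate (m : ℕ) (β : ℝ) :
    (Multiset.replicate m β).esymm 2 = m * (m - 1) / 2 * β ^ 2 := by
  induction m with
  | zero => simp [Multiset.esymm, Multiset.powersetCard_zero_right 1]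
  | succ m ih =>
    rw [Multiset.replicate_succ, esymm_two_cons, ih]
    simp
    ring

/-! ### The hyperboloid -/

variable {n : ℕ}

theorem lorentz_comm (X Y : Minkowski n) : lorentz X Y = lorentz Y X := by
  simp only [lorentz, real_inner_comm]
  ring

theorem lorentz_add_right (X Y Z : Minkowski n) :
    lorentz X (Y + Z) = lorentz X Y + lorentz X Z := by
  simp only [lorentz, Prod.fst_add, Prod.snd_add, inner_add_right]
  ring

theorem lorentz_smul_right (a : ℝ) (X Y : Minkowski n) :
    lorentz X (a • Y) = a * lorentz X Y := by
  simp only [lorentz, Prod.smul_fst, Prod.smul_snd, inner_smul_right, smul_eq_mul]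
  ring

theorem lorentz_sub_right (X Y Z : Minkowski n) :
    lorentz X (Y - Z) = lorentz X Y - lorentz X Z := by
  simp only [lorentz, Prod.fst_sub, Prod.snd_sub, inner_sub_right]
  ring

theorem lorentz_add_left (X Y Z : Minkowski n) :
    lorentz (X + Y) Z = lorentz X Z + lorentz Y Z := by
  rw [lorentz_comm, lorentz_add_right, lorentz_comm Z, lorentz_comm Z]

theorem lorentz_smul_left (a : ℝ) (X Y : Minkowski n) :
    lorentz (a • X) Y = a * lorentz X Y := by
  rw [lorentz_comm, lorentz_smul_right, lorentz_comm Y]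

theorem lorentz_sub_left (X Y Z : Minkowski n) :
    lorentz (X - Y) Z = lorentz X Z - lorentz Y Z := by
  rw [lorentz_comm, lorentz_sub_right, lorentz_comm Z, lorentz_comm Z]

/-- `lorentz X` as a continuous linear form. -/
def lorentzL (X : Minkowski n) : Minkowski n →L[ℝ] ℝ :=
  (innerSL ℝ X.1).comp (.fst ℝ _ _) - X.2 • .snd ℝ _ _

theorem lorentzL_apply (X Y : Minkowski n) : lorentzL X Y = lorentz X Y := by
  simp [lorentzL, lorentz]

theorem sqrt_one_add_sq_pos (y : EuclideanSpace ℝ (Fin n)) : 0 < √(1 + ‖y‖ ^ 2) :=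
  Real.sqrt_pos.2 (by positivity)

theorem sq_sqrt_one_add_sq (y : EuclideanSpace ℝ (Fin n)) : √(1 + ‖y‖ ^ 2) ^ 2 = 1 + ‖y‖ ^ 2 :=
  Real.sq_sqrt (by positivity)

theorem lift_fst (x : hyperboloid n) : lift x.1.1 = x := by
  obtain ⟨⟨y, t⟩, h1, h2⟩ := x
  refine Subtype.ext (Prod.ext rfl ?_)
  simp only [lorentz, real_inner_self_eq_norm_sq] at h1
  have : 1 + ‖y‖ ^ 2 = t ^ 2 := by linarith
  simp only [lift, this]
  exact Real.sqrt_sq h2.le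

/-- The derivative of the inverse chart `lift` of the hyperboloid. -/
def liftDeriv (y : EuclideanSpace ℝ (Fin n)) : EuclideanSpace ℝ (Fin n) →L[ℝ] Minkowski n :=
  (ContinuousLinearMap.id ℝ _).prod ((√(1 + ‖y‖ ^ 2))⁻¹ • innerSL ℝ y)

theorem liftDeriv_apply (y v : EuclideanSpace ℝ (Fin n)) :
    liftDeriv y v = (v, (√(1 + ‖y‖ ^ 2))⁻¹ * inner ℝ y v) := by
  simp [liftDeriv]

theorem hasFDerivAt_lift (y : EuclideanSpace ℝ (Fin n)) :
    HasFDerivAt (fun y => (lift y : Minkowski n)) (liftDeriv y) y := by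
  have h1 : HasFDerivAt (fun y : EuclideanSpace ℝ (Fin n) => 1 + ‖y‖ ^ 2) (2 • innerSL ℝ y) y := by
    simpa using ((hasFDerivAt_id y).norm_sq).const_add 1
  have h2 := h1.sqrt (by positivity)
  refine (hasFDerivAt_id y).prodMk (h2.congr_fderiv ?_)
  ext v
  simp
  field_simp

theorem contDiff_lift {m : WithTop ℕ∞} :
    ContDiff ℝ m fun y : EuclideanSpace ℝ (Fin n) => (lift y : Minkowski n) :=
  contDiff_id.prodMk ((contDiff_const.add (contDiff_norm_sq ℝ)).sqrt fun y => by positivity)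

theorem lorentz_lift_self (y : EuclideanSpace ℝ (Fin n)) :
    lorentz (lift y : Minkowski n) (lift y) = -1 :=
  (lift y).2.1

theorem lorentz_lift_liftDeriv (y v : EuclideanSpace ℝ (Fin n)) :
    lorentz (lift y : Minkowski n) (liftDeriv y v) = 0 := by
  have := (sqrt_one_add_sq_pos y).ne'
  simp only [liftDeriv_apply, lorentz, lift]
  field_simp
  ring

/-- The tangent space of the hyperboloid is spacelike. -/
theorem lorentz_liftDeriv_self_pos (y : EuclideanSpace ℝ (Fin n)) {v : EuclideanSpace ℝ (Fin n)}
    (hv : v ≠ 0) : 0 < lorentz (liftDeriv y v) (liftDeriv y v) := by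
  have hq := sqrt_one_add_sq_pos y
  have hq2 := sq_sqrt_one_add_sq y
  have hcs := real_inner_mul_inner_self_le y v
  have hv' : 0 < ‖v‖ ^ 2 := by positivity
  simp only [real_inner_self_eq_norm_sq] at hcs
  simp only [liftDeriv_apply, lorentz, real_inner_self_eq_norm_sq]
  have : ‖v‖ ^ 2 - (√(1 + ‖y‖ ^ 2))⁻¹ * inner ℝ y v * ((√(1 + ‖y‖ ^ 2))⁻¹ * inner ℝ y v) =
      (‖v‖ ^ 2 * √(1 + ‖y‖ ^ 2) ^ 2 - inner ℝ y v * inner ℝ y v) / √(1 + ‖y‖ ^ 2) ^ 2 := by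
    field_simp
  rw [this, hq2]
  apply div_pos _ (by positivity)
  nlinarith

/-- A vector orthogonal to the tangent space of the hyperboloid at `x` is a multiple of `x`. -/
theorem exists_eq_smul_lift {y : EuclideanSpace ℝ (Fin n)} {K : Minkowski n}
    (h : ∀ v, lorentz K (liftDeriv y v) = 0) : ∃ μ : ℝ, K = μ • (lift y : Minkowski n) := by
  have hq := (sqrt_one_add_sq_pos y).ne'
  refine ⟨K.2 / √(1 + ‖y‖ ^ 2), Prod.ext ?_ ?_⟩
  · refine ext_inner_right ℝ fun v => ?_
    have := h v
    simp only [liftDeriv_apply, lorentz, lift, Prod.smul_fst, inner_smul_left] at this ⊢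
    simp only [conj_trivial]
    rw [sub_eq_zero.1 this]
    ring
  · simp [lift, div_mul_cancel₀ _ hq]

/-! ### The height function `c = cosh r` -/

/-- The function `c(x) = -⟨o, x⟩ = cosh r(x)`, read in the global chart. -/
def height (o : hyperboloid n) (y : EuclideanSpace ℝ (Fin n)) : ℝ := -lorentz o.1 (lift y).1

variable (o : hyperboloid n) (y v : EuclideanSpace ℝ (Fin n))

/-- The differential of `height o`. -/
def heightDeriv : EuclideanSpace ℝ (Fin n) →L[ℝ] ℝ := -(lorentzL o.1).comp (liftDeriv y)

theorem heightDeriv_apply : heightDeriv o y v = -lorentz o.1 (liftDeriv y v) := by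
  simp [heightDeriv, lorentzL_apply]

theorem hasFDerivAt_height : HasFDerivAt (height o) (heightDeriv o y) y := by
  have h := ((lorentzL o.1).hasFDerivAt.comp y (hasFDerivAt_lift y)).neg
  refine h.congr_of_eventuallyEq (Filter.Eventually.of_forall fun z => ?_)
  simp [height, lorentzL_apply]

theorem contDiff_height {m : WithTop ℕ∞} : ContDiff ℝ m (height o) := by
  have h := ((lorentzL o.1).contDiff (n := m).comp (contDiff_lift (n := n))).neg
  convert! h using 2

theorem lorentz_o_lift : lorentz o.1 (lift y).1 = -height o y := by simp [height]

/-- The gradient of `height o`, read in the chart. -/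
def heightGrad : EuclideanSpace ℝ (Fin n) := height o y • y - o.1.1

theorem liftDeriv_heightGrad :
    liftDeriv y (heightGrad o y) = height o y • (lift y : Minkowski n) - o.1 := by
  have hq := (sqrt_one_add_sq_pos y).ne'
  have hq2 := sq_sqrt_one_add_sq y
  have hc : height o y = o.1.2 * √(1 + ‖y‖ ^ 2) - inner ℝ o.1.1 y := by
    simp [height, lorentz, lift]
  rw [liftDeriv_apply]
  refine Prod.ext rfl ?_
  simp only [heightGrad, inner_sub_right, inner_smul_right, real_inner_self_eq_norm_sq, lift,
    Prod.snd_sub, Prod.smul_snd, smul_eq_mul]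
  have e : ‖y‖ ^ 2 = √(1 + ‖y‖ ^ 2) ^ 2 - 1 := by rw [hq2]; ring
  have e2 : inner ℝ y o.1.1 = o.1.2 * √(1 + ‖y‖ ^ 2) - height o y := by
    rw [hc, real_inner_comm]; ring
  rw [e2]
  generalize √(1 + ‖y‖ ^ 2) = s at *
  rw [e]
  field_simp
  ring

theorem lorentz_heightGrad_left :
    lorentz (liftDeriv y (heightGrad o y)) (liftDeriv y v) = heightDeriv o y v := by
  rw [liftDeriv_heightGrad, lorentz_sub_left, lorentz_smul_left, lorentz_lift_liftDeriv,
    heightDeriv_apply]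
  ring

theorem heightDeriv_heightGrad : heightDeriv o y (heightGrad o y) = height o y ^ 2 - 1 := by
  rw [heightDeriv_apply, liftDeriv_heightGrad, lorentz_sub_right, lorentz_smul_right,
    lorentz_o_lift, o.2.1]
  ring

theorem height_sq_ge : 0 ≤ height o y ^ 2 - 1 := by
  rw [← heightDeriv_heightGrad, ← lorentz_heightGrad_left]
  by_cases h : heightGrad o y = 0
  · rw [h, map_zero]
    simp [lorentz]
  · exact (lorentz_liftDeriv_self_pos y h).le

theorem one_le_height : 1 ≤ height o y := by
  have h1 := height_sq_ge o y
  have h2 : 0 < height o y := by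
    obtain ⟨ho, ho2⟩ := o.2
    have hq := sqrt_one_add_sq_pos y
    have hq2 := sq_sqrt_one_add_sq y
    simp only [lorentz, real_inner_self_eq_norm_sq] at ho
    have h3 : height o y = o.1.2 * √(1 + ‖y‖ ^ 2) - inner ℝ o.1.1 y := by
      simp [height, lorentz, lift]
    have h4 := real_inner_le_norm o.1.1 y
    have h5 : ‖o.1.1‖ < o.1.2 := by
      refine lt_of_pow_lt_pow_left₀ 2 ho2.le ?_
      linarith
    have h6 : ‖y‖ < √(1 + ‖y‖ ^ 2) := by
      refine lt_of_pow_lt_pow_left₀ 2 hq.le ?_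
      linarith
    have h7 : ‖o.1.1‖ * ‖y‖ < o.1.2 * √(1 + ‖y‖ ^ 2) :=
      mul_lt_mul'' h5 h6 (norm_nonneg _) (norm_nonneg _)
    linarith
  nlinarith

/-- The Cauchy–Schwarz inequality for the gradient of `height o`, whose square is `c² - 1`. -/
theorem heightDeriv_sq_le :
    heightDeriv o y v ^ 2 ≤ (height o y ^ 2 - 1) * lorentz (liftDeriv y v) (liftDeriv y v) := by
  have hnn : ∀ u, 0 ≤ lorentz (liftDeriv y u) (liftDeriv y u) := by
    intro u
    by_cases h : u = 0
    · rw [h, map_zero]; simp [lorentz]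
    · exact (lorentz_liftDeriv_self_pos y h).le
  rcases (height_sq_ge o y).eq_or_lt with h | h
  · have hz : heightGrad o y = 0 := by
      by_contra hz
      have h1 := lorentz_liftDeriv_self_pos y hz
      rw [lorentz_heightGrad_left, heightDeriv_heightGrad, ← h] at h1
      exact lt_irrefl _ h1
    rw [← lorentz_heightGrad_left, hz, ← h, map_zero]
    simp [lorentz]
  · have h1 := hnn ((height o y ^ 2 - 1) • v - heightDeriv o y v • heightGrad o y)
    simp only [map_sub, map_smul, lorentz_sub_left, lorentz_sub_right, lorentz_smul_left,
      lorentz_smul_right, lorentz_heightGrad_left, lorentz_comm (liftDeriv y v)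
      (liftDeriv y (heightGrad o y)), heightDeriv_heightGrad] at h1
    by_contra hcon
    push Not at hcon
    nlinarith

theorem hypDist_lift : hypDist o (lift y) = Real.arcosh (height o y) := rfl

end RadialGraph

namespace RadialGraph

/-! ### The curvature of a radial graph -/

open Filter Topology

variable {n : ℕ} (o : hyperboloid n) (y : EuclideanSpace ℝ (Fin n))

/-- The differential of the graph parametrization `e^{P(c(x))} x`, where `e = e^{P(c)}` and
`s = P'(c)`. -/
def graphDeriv (e s : ℝ) : EuclideanSpace ℝ (Fin n) →L[ℝ] Minkowski n :=
  e • (liftDeriv y + (s • heightDeriv o y).smulRight (lift y : Minkowski n))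

theorem graphDeriv_apply (e s : ℝ) (v : EuclideanSpace ℝ (Fin n)) :
    graphDeriv o y e s v =
      e • (liftDeriv y v + (s * heightDeriv o y v) • (lift y : Minkowski n)) := by
  simp [graphDeriv]

variable {o y}

theorem hasFDerivAt_graphParam {φ : hyperboloid n → ℝ} {P : ℝ → ℝ} {s : ℝ}
    (hφ : ∀ y, φ (lift y) = P (height o y)) (hP : HasDerivAt P s (height o y)) :
    HasFDerivAt (graphParam φ) (graphDeriv o y (Real.exp (P (height o y))) s) y := by
  have h1 := (hP.exp.comp_hasFDerivAt y (hasFDerivAt_height o y)).smul (hasFDerivAt_lift y)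
  have h2 : graphParam φ = fun y => Real.exp (P (height o y)) • (lift y : Minkowski n) := by
    funext y
    simp only [graphParam, hφ]
  rw [h2]
  refine h1.congr_fderiv ?_
  ext1 v
  simp [graphDeriv_apply, smul_smul, mul_assoc]

theorem lorentz_graphDeriv_self (e s : ℝ) (v : EuclideanSpace ℝ (Fin n)) :
    lorentz (graphDeriv o y e s v) (graphDeriv o y e s v) =
      e ^ 2 * (lorentz (liftDeriv y v) (liftDeriv y v) - s ^ 2 * heightDeriv o y v ^ 2) := by
  simp only [graphDeriv_apply, lorentz_smul_left, lorentz_smul_right, lorentz_add_left,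
    lorentz_add_right, lorentz_lift_self, lorentz_lift_liftDeriv,
    lorentz_comm (liftDeriv y v) (lift y : Minkowski n)]
  ring

theorem lorentz_graphDeriv_self_pos {e s : ℝ} (he : 0 < e)
    (hw : 0 < 1 - s ^ 2 * (height o y ^ 2 - 1)) {v : EuclideanSpace ℝ (Fin n)} (hv : v ≠ 0) :
    0 < lorentz (graphDeriv o y e s v) (graphDeriv o y e s v) := by
  rw [lorentz_graphDeriv_self]
  have h1 := lorentz_liftDeriv_self_pos y hv
  have h2 := mul_le_mul_of_nonneg_left (heightDeriv_sq_le o y v) (sq_nonneg s)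
  have h3 := mul_pos hw h1
  exact mul_pos (by positivity) (by nlinarith)

theorem isSpacelike_graphParam {φ : hyperboloid n → ℝ} {P p : ℝ → ℝ}
    (hφ : ∀ y, φ (lift y) = P (height o y)) (hP : ∀ c, 1 ≤ c → HasDerivAt P (p c) c)
    (hw : ∀ c, 1 ≤ c → 0 < 1 - p c ^ 2 * (c ^ 2 - 1)) : IsSpacelike (graphParam φ) := by
  have h := fun y => hasFDerivAt_graphParam hφ (hP _ (one_le_height o y))
  refine ⟨fun y => (h y).differentiableAt, fun y v hv => ?_⟩
  rw [(h y).fderiv]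
  exact lorentz_graphDeriv_self_pos (Real.exp_pos _) (hw _ (one_le_height o y)) hv

variable (o y) in
/-- The future unit normal `((1 + s c) x - s o) / √(1 - s² (c² - 1))` of a radial graph with slope
`s = P'(c)`. -/
def normalVec (s : ℝ) : Minkowski n :=
  (√(1 - s ^ 2 * (height o y ^ 2 - 1)))⁻¹ •
    ((1 + s * height o y) • (lift y : Minkowski n) - s • o.1)

theorem lorentz_lift_o : lorentz (lift y).1 o.1 = -height o y := by
  rw [lorentz_comm, lorentz_o_lift]

theorem pos_snd_of_lorentz_lift_neg {N : Minkowski n} (h1 : lorentz N N = -1)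
    (h2 : lorentz N (lift y).1 < 0) : 0 < N.2 := by
  by_contra! hN
  have hq := sqrt_one_add_sq_pos y
  have hq2 := sq_sqrt_one_add_sq y
  simp only [lorentz, lift, real_inner_self_eq_norm_sq] at h1 h2
  have h3 := neg_le_of_abs_le (abs_real_inner_le_norm N.1 y)
  have h4 : ‖N.1‖ ≤ -N.2 := by
    refine (pow_le_pow_iff_left₀ (norm_nonneg _) (by linarith) two_ne_zero).1 ?_
    linarith
  have h5 : ‖y‖ ≤ √(1 + ‖y‖ ^ 2) := by
    refine (pow_le_pow_iff_left₀ (norm_nonneg _) hq.le two_ne_zero).1 ?_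
    linarith
  have h6 : ‖N.1‖ * ‖y‖ ≤ -N.2 * √(1 + ‖y‖ ^ 2) :=
    mul_le_mul h4 h5 (norm_nonneg _) (by linarith)
  linarith

theorem isFutureUnitNormal_normalVec {F : EuclideanSpace ℝ (Fin n) → Minkowski n} {e s : ℝ}
    (hF : fderiv ℝ F y = graphDeriv o y e s) (hw : 0 < 1 - s ^ 2 * (height o y ^ 2 - 1)) :
    IsFutureUnitNormal F y (normalVec o y s) := by
  have hs := Real.sqrt_pos.2 hw
  have hs2 := Real.sq_sqrt hw.le
  have h1 : lorentz (normalVec o y s) (normalVec o y s) = -1 := by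
    simp only [normalVec, lorentz_smul_left, lorentz_smul_right, lorentz_sub_left,
      lorentz_sub_right, lorentz_lift_self, lorentz_lift_o (o := o), lorentz_o_lift o y, o.2.1]
    field_simp
    rw [hs2]
    ring
  refine ⟨h1, pos_snd_of_lorentz_lift_neg (y := y) h1 ?_, fun v => ?_⟩
  · have : lorentz (normalVec o y s) (lift y).1 = -(√(1 - s ^ 2 * (height o y ^ 2 - 1)))⁻¹ := by
      simp only [normalVec, lorentz_smul_left, lorentz_sub_left, lorentz_lift_self,
        lorentz_o_lift o y]
      ring
    rw [this, neg_lt_zero]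
    positivity
  · rw [hF]
    have := heightDeriv_apply o y v
    simp only [normalVec, graphDeriv_apply, lorentz_smul_left, lorentz_smul_right,
      lorentz_sub_left, lorentz_add_right, lorentz_lift_self, lorentz_lift_liftDeriv,
      lorentz_o_lift o y, neg_eq_iff_eq_neg.1 this.symm]
    ring

theorem IsFutureUnitNormal.eq_normalVec {F : EuclideanSpace ℝ (Fin n) → Minkowski n} {e s : ℝ}
    (hF : fderiv ℝ F y = graphDeriv o y e s) (he : 0 < e)
    (hw : 0 < 1 - s ^ 2 * (height o y ^ 2 - 1)) {N : Minkowski n}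
    (hN : IsFutureUnitNormal F y N) : N = normalVec o y s := by
  obtain ⟨h1, h2, h3⟩ := isFutureUnitNormal_normalVec hF hw
  obtain ⟨hN1, hN2, hN3⟩ := hN
  have hs := Real.sqrt_pos.2 hw
  -- `N` is orthogonal to the tangent space, hence in the plane of `x` and `o`.
  set β := lorentz N (lift y).1 with hβ
  have h4 : ∀ v, lorentz N (liftDeriv y v) = -(s * heightDeriv o y v * β) := by
    intro v
    have := hN3 v
    rw [hF, graphDeriv_apply, lorentz_smul_right, lorentz_add_right, lorentz_smul_right] at this
    have := (mul_eq_zero.1 this).resolve_left he.ne'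
    linarith
  obtain ⟨μ, hμ⟩ := exists_eq_smul_lift (y := y) (K := N - (s * β) • o.1) fun v => by
    rw [lorentz_sub_left, h4, lorentz_smul_left, heightDeriv_apply]
    ring
  have h5 : N = μ • (lift y).1 + (s * β) • o.1 := by rw [← hμ]; abel
  have h6 : β = -μ - s * β * height o y := by
    conv_lhs => rw [hβ, h5]
    rw [lorentz_add_left, lorentz_smul_left, lorentz_smul_left, lorentz_lift_self,
        lorentz_o_lift o y]
    ring
  have h7 : N = (-β * √(1 - s ^ 2 * (height o y ^ 2 - 1))) • normalVec o y s := by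
    rw [normalVec, smul_smul, mul_assoc, mul_inv_cancel₀ hs.ne', mul_one, h5]
    have : μ = -β * (1 + s * height o y) := by linarith
    rw [this]
    module
  set k := -β * √(1 - s ^ 2 * (height o y ^ 2 - 1))
  have h8 : k ^ 2 = 1 := by
    rw [h7, lorentz_smul_left, lorentz_smul_right, h1] at hN1
    linarith
  have h9 : 0 < k := by
    rw [h7] at hN2
    exact pos_of_mul_pos_left hN2 h2.le
  have h10 : k = 1 := by nlinarith
  rw [h7, h10, one_smul]

theorem unitNormal_eq_normalVec {F : EuclideanSpace ℝ (Fin n) → Minkowski n} {e s : ℝ}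
    (hF : fderiv ℝ F y = graphDeriv o y e s) (he : 0 < e)
    (hw : 0 < 1 - s ^ 2 * (height o y ^ 2 - 1)) : unitNormal F y = normalVec o y s :=
  IsFutureUnitNormal.eq_normalVec hF he hw
    (Classical.epsilon_spec ⟨_, isFutureUnitNormal_normalVec hF hw⟩)

theorem hasFDerivAt_comp_height {a b : ℝ → ℝ} {a' b' : ℝ} (hb : HasDerivAt b b' (height o y))
    (ha : HasDerivAt a a' (height o y)) :
    HasFDerivAt (fun z => b (height o z) • (lift z : Minkowski n) + a (height o z) • o.1)
      (b (height o y) • liftDeriv y + (b' • heightDeriv o y).smulRight (lift y : Minkowski n) +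
        (a' • heightDeriv o y).smulRight o.1) y := by
  have hh := hasFDerivAt_height o y
  have h1 := (hb.comp_hasFDerivAt y hh).smul (hasFDerivAt_lift y)
  have h2 := (ha.comp_hasFDerivAt y hh).smul_const o.1
  exact h1.add h2

/-- The tangential curvature of a radial graph, multiplied by `e^φ`. -/
def tangentialCurv (c s : ℝ) : ℝ := (1 + s * c) / √(1 - s ^ 2 * (c ^ 2 - 1))

/-- The radial curvature of a radial graph, multiplied by `e^φ`; here `s = P'(c)`, `s' = P''(c)`. -/
def radialCurv (c s s' : ℝ) : ℝ :=
  (1 - s ^ 2 * (c ^ 2 - 1) + s * c + s' * (c ^ 2 - 1)) / √(1 - s ^ 2 * (c ^ 2 - 1)) ^ 3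

/-- The curvature endomorphism of a radial graph is a scalar plus an endomorphism of rank one in
the radial direction. -/
theorem curvatureEnd_graphParam {φ : hyperboloid n → ℝ} {P p : ℝ → ℝ} {s' : ℝ}
    (hφ : ∀ y, φ (lift y) = P (height o y))
    (hP : ∀ᶠ t in 𝓝 (height o y), HasDerivAt P (p t) t)
    (hp : HasDerivAt p s' (height o y))
    (hw : 0 < 1 - p (height o y) ^ 2 * (height o y ^ 2 - 1)) :
    curvatureEnd (graphParam φ) y =
      ((Real.exp (P (height o y)))⁻¹ * tangentialCurv (height o y) (p (height o y))) •
        (1 : Module.End ℝ (EuclideanSpace ℝ (Fin n))) +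
      (((Real.exp (P (height o y)))⁻¹ * ((s' + p (height o y) ^ 3 * height o y) /
        √(1 - p (height o y) ^ 2 * (height o y ^ 2 - 1)) ^ 3)) •
        (heightDeriv o y : EuclideanSpace ℝ (Fin n) →ₗ[ℝ] ℝ)).smulRight (heightGrad o y) := by
  set c := height o y with hc
  set s := p c with hs
  set w := 1 - s ^ 2 * (c ^ 2 - 1) with hwdef
  set e := Real.exp (P c) with he
  have he0 : 0 < e := Real.exp_pos _
  have hσ := Real.sqrt_pos.2 hw
  have hσ2 := Real.sq_sqrt hw.le
  have hcc : ContinuousAt (height o) y := (hasFDerivAt_height o y).continuousAt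
  have hF : ∀ᶠ z in 𝓝 y, fderiv ℝ (graphParam φ) z =
      graphDeriv o z (Real.exp (P (height o z))) (p (height o z)) := by
    filter_upwards [hcc.eventually hP] with z hz
    exact (hasFDerivAt_graphParam hφ hz).fderiv
  have hFy := hF.self_of_nhds
  have hwev : ∀ᶠ z in 𝓝 y, 0 < 1 - p (height o z) ^ 2 * (height o z ^ 2 - 1) := by
    have h1 : ContinuousAt (fun z => p (height o z)) y :=
      ContinuousAt.comp (f := height o) hp.continuousAt hcc
    have h2 : ContinuousAt (fun z => 1 - p (height o z) ^ 2 * (height o z ^ 2 - 1)) y :=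
      continuousAt_const.sub ((h1.pow 2).mul ((hcc.pow 2).sub continuousAt_const))
    exact h2.eventually_const_lt hw
  -- Near `y` the unit normal is `b(c) x + a(c) o`.
  let b : ℝ → ℝ := fun t => (1 + p t * t) / √(1 - p t ^ 2 * (t ^ 2 - 1))
  let a : ℝ → ℝ := fun t => -p t / √(1 - p t ^ 2 * (t ^ 2 - 1))
  have hN : unitNormal (graphParam φ) =ᶠ[𝓝 y] fun z =>
      b (height o z) • (lift z : Minkowski n) + a (height o z) • o.1 := by
    filter_upwards [hF, hwev] with z h1 h2
    rw [unitNormal_eq_normalVec h1 (Real.exp_pos _) h2, normalVec]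
    simp only [a, b, div_eq_mul_inv]
    module
  set k := (s' + s ^ 3 * c) / √w ^ 3 with hk
  have hwd : HasDerivAt (fun t => 1 - p t ^ 2 * (t ^ 2 - 1))
      (-(2 * s * s' * (c ^ 2 - 1) + s ^ 2 * (2 * c))) c := by
    refine (((hp.pow 2).mul ((hasDerivAt_pow 2 c).sub_const 1)).const_sub 1).congr_deriv ?_
    simp only [Pi.pow_apply, ← hs]
    push_cast
    ring
  have hsd := hwd.sqrt hw.ne'
  have hid := hasDerivAt_id c
  have ha : HasDerivAt a (-k) c := by
    refine (hp.neg.div hsd hσ.ne').congr_deriv ?_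
    simp only [Pi.neg_apply, ← hs, ← hwdef, hk]
    field_simp
    rw [hσ2, hwdef]
    ring
  have hb : HasDerivAt b (k * c + s * ((1 + s * c) / √w + k * (c ^ 2 - 1))) c := by
    refine (((hp.mul hid).const_add 1).div hsd hσ.ne').congr_deriv ?_
    simp only [Pi.mul_apply, id, ← hs, ← hwdef, hk]
    field_simp
    rw [hσ2, hwdef]
    ring
  have hNd := (hasFDerivAt_comp_height (a := a) (b := b) hb ha).congr_of_eventuallyEq hN
  -- Compare `dF ∘ S` with `dN`; the endomorphism `S` is unique because `dF` is injective.
  have hinj : ∀ u v, fderiv ℝ (graphParam φ) y u = fderiv ℝ (graphParam φ) y v → u = v := by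
    intro u v huv
    by_contra hne
    have h1 := lorentz_graphDeriv_self_pos he0 hw (sub_ne_zero.2 hne)
    rw [hFy, ← sub_eq_zero, ← map_sub] at huv
    rw [huv] at h1
    simp [lorentz] at h1
  set S : Module.End ℝ (EuclideanSpace ℝ (Fin n)) :=
    (e⁻¹ * tangentialCurv c s) • (1 : Module.End ℝ (EuclideanSpace ℝ (Fin n))) +
      ((e⁻¹ * k) • (heightDeriv o y : EuclideanSpace ℝ (Fin n) →ₗ[ℝ] ℝ)).smulRight
        (heightGrad o y) with hS
  have hSspec : ∀ v,
      fderiv ℝ (graphParam φ) y (S v) = fderiv ℝ (unitNormal (graphParam φ)) y v := by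
    intro v
    have hSv : S v = e⁻¹ • (((1 + s * c) / √w) • v +
        (k * heightDeriv o y v) • heightGrad o y) := by
      simp only [hS, LinearMap.add_apply, LinearMap.smul_apply, Module.End.one_apply,
        LinearMap.smulRight_apply, ContinuousLinearMap.coe_coe, smul_eq_mul, tangentialCurv,
        ← hwdef]
      module
    rw [hFy, hNd.fderiv, hSv, map_smul, graphDeriv_apply, smul_smul, inv_mul_cancel₀ he0.ne',
      one_smul, map_add, map_smul, map_smul, map_add, map_smul, map_smul, liftDeriv_heightGrad,
      heightDeriv_heightGrad]
    simp only [add_apply, smul_apply, ContinuousLinearMap.smulRight_apply, smul_eq_mul, ← hc,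
      ← hs, b, ← hwdef]
    module
  have hspec := Classical.epsilon_spec (p := fun S : Module.End ℝ (EuclideanSpace ℝ (Fin n)) =>
    ∀ v, fderiv ℝ (graphParam φ) y (S v) = fderiv ℝ (unitNormal (graphParam φ)) y v) ⟨S, hSspec⟩
  refine LinearMap.ext fun v => hinj _ _ ?_
  rw [hSspec v]
  exact hspec v

/-- The principal curvatures of a radial graph: the radial one and `n - 1` tangential ones. -/
theorem principalCurvatures_graphParam (hn : 1 ≤ n) {φ : hyperboloid n → ℝ} {P p : ℝ → ℝ} {s' : ℝ}
    (hφ : ∀ y, φ (lift y) = P (height o y))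
    (hP : ∀ᶠ t in 𝓝 (height o y), HasDerivAt P (p t) t)
    (hp : HasDerivAt p s' (height o y))
    (hw : 0 < 1 - p (height o y) ^ 2 * (height o y ^ 2 - 1)) :
    principalCurvatures (graphParam φ) y =
      ((Real.exp (P (height o y)))⁻¹ * radialCurv (height o y) (p (height o y)) s') ::ₘ
      Multiset.replicate (n - 1)
        ((Real.exp (P (height o y)))⁻¹ * tangentialCurv (height o y) (p (height o y))) := by
  have hfr : Module.finrank ℝ (EuclideanSpace ℝ (Fin n)) = n := finrank_euclideanSpace_fin
  rw [principalCurvatures, curvatureEnd_graphParam hφ hP hp hw,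
    charpoly_smul_one_add_smulRight _ _ _ (hfr.symm ▸ hn), hfr, Polynomial.roots_mul,
    Polynomial.roots_pow, Polynomial.roots_X_sub_C, Polynomial.roots_X_sub_C,
    Multiset.nsmul_singleton]
  · rw [Multiset.singleton_add]
    congr 1
    simp only [LinearMap.smul_apply, ContinuousLinearMap.coe_coe, heightDeriv_heightGrad,
      smul_eq_mul, tangentialCurv, radialCurv]
    have hσ := Real.sqrt_pos.2 hw
    have hσ2 := Real.sq_sqrt hw.le
    field_simp
    rw [hσ2]
    ring
  · exact (Polynomial.monic_X_sub_C _).mul ((Polynomial.monic_X_sub_C _).pow _) |>.ne_zero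

end RadialGraph

namespace RadialGraph

/-! ### The curvature equation as a differential equation -/

open Filter Topology

variable {n : ℕ} {o : hyperboloid n} {y : EuclideanSpace ℝ (Fin n)}

theorem meanCurvature_one_graphParam (hn : 1 ≤ n) {φ : hyperboloid n → ℝ} {P p : ℝ → ℝ} {s' : ℝ}
    (hφ : ∀ y, φ (lift y) = P (height o y))
    (hP : ∀ᶠ t in 𝓝 (height o y), HasDerivAt P (p t) t)
    (hp : HasDerivAt p s' (height o y))
    (hw : 0 < 1 - p (height o y) ^ 2 * (height o y ^ 2 - 1)) :
    meanCurvature 1 (graphParam φ) y = (Real.exp (P (height o y)))⁻¹ *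
      (radialCurv (height o y) (p (height o y)) s' +
        (n - 1) * tangentialCurv (height o y) (p (height o y))) := by
  rw [meanCurvature, principalCurvatures_graphParam hn hφ hP hp hw, esymm_one_eq_sum,
    Multiset.sum_cons, Multiset.sum_replicate, nsmul_eq_mul, Nat.cast_sub hn, Nat.cast_one]
  ring

theorem meanCurvature_two_graphParam (hn : 1 ≤ n) {φ : hyperboloid n → ℝ} {P p : ℝ → ℝ} {s' : ℝ}
    (hφ : ∀ y, φ (lift y) = P (height o y))
    (hP : ∀ᶠ t in 𝓝 (height o y), HasDerivAt P (p t) t)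
    (hp : HasDerivAt p s' (height o y))
    (hw : 0 < 1 - p (height o y) ^ 2 * (height o y ^ 2 - 1)) :
    meanCurvature 2 (graphParam φ) y = (Real.exp (P (height o y)))⁻¹ ^ 2 *
      ((n - 1) / 2 * ((n - 2) * tangentialCurv (height o y) (p (height o y)) ^ 2 +
        2 * (radialCurv (height o y) (p (height o y)) s' *
          tangentialCurv (height o y) (p (height o y))))) := by
  rw [meanCurvature, principalCurvatures_graphParam hn hφ hP hp hw, esymm_two_cons,
    esymm_two_replicate, Multiset.sum_replicate, nsmul_eq_mul, Nat.cast_sub hn, Nat.cast_one]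
  ring

/-- In terms of the scaled curvatures, `F₂² = ((n - 2) b² + 2 a b) / n`. -/
theorem mul_rpow_half_eq_iff {m e V h : ℝ} (hm : 2 ≤ m) (he : 0 < e) (hh : 0 < h) :
    e * (e⁻¹ ^ 2 * ((m - 1) / 2 * V) / (m * (m - 1) / 2)) ^ (1 / (2 : ℝ)) = h ↔ V = m * h ^ 2 := by
  have h1 : e⁻¹ ^ 2 * ((m - 1) / 2 * V) / (m * (m - 1) / 2) = V / m * e⁻¹ ^ 2 := by
    have : m - 1 ≠ 0 := by linarith
    field_simp
  rw [h1, ← Real.sqrt_eq_rpow, Real.sqrt_mul' _ (by positivity), Real.sqrt_sq (by positivity),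
    mul_comm, inv_mul_cancel_right₀ he.ne', Real.sqrt_eq_iff_mul_self_eq_of_pos hh]
  have hm0 : m ≠ 0 := by linarith
  rw [eq_div_iff hm0, eq_comm, sq, mul_comm m]

theorem radialOp_two_eq_iff (hn : 2 ≤ n) {φ : hyperboloid n → ℝ} {P p : ℝ → ℝ} {s' h : ℝ}
    (hφ : ∀ y, φ (lift y) = P (height o y))
    (hP : ∀ᶠ t in 𝓝 (height o y), HasDerivAt P (p t) t)
    (hp : HasDerivAt p s' (height o y))
    (hw : 0 < 1 - p (height o y) ^ 2 * (height o y ^ 2 - 1)) (hh : 0 < h) :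
    radialOp 2 φ (lift y) = h ↔
      (n - 2) * tangentialCurv (height o y) (p (height o y)) ^ 2 +
        2 * (radialCurv (height o y) (p (height o y)) s' *
          tangentialCurv (height o y) (p (height o y))) = n * h ^ 2 := by
  rw [← mul_rpow_half_eq_iff (m := n) (by exact_mod_cast hn) (Real.exp_pos (P (height o y))) hh,
    radialOp, hφ]
  have e : ((lift y : hyperboloid n) : Minkowski n).1 = y := rfl
  rw [e, meanCurvature_two_graphParam (by omega) hφ hP hp hw, Nat.cast_choose_two, Nat.cast_two]

/-- The curvature equation with the square roots cleared; it makes sense at the pole `c = 1`. -/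
theorem curvature_eq_iff_polynomial {m c s s' h : ℝ} (hw : 0 < 1 - s ^ 2 * (c ^ 2 - 1)) :
    (m - 2) * tangentialCurv c s ^ 2 + 2 * (radialCurv c s s' * tangentialCurv c s) = m * h ^ 2 ↔
      (1 + s * c) * ((m - 2) * (1 + s * c) * (1 - s ^ 2 * (c ^ 2 - 1)) +
        2 * (1 - s ^ 2 * (c ^ 2 - 1) + (s * c + s' * (c ^ 2 - 1)))) =
      m * h ^ 2 * (1 - s ^ 2 * (c ^ 2 - 1)) ^ 2 := by
  have hσ := Real.sqrt_pos.2 hw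
  have hσ2 := Real.sq_sqrt hw.le
  have hb : tangentialCurv c s ^ 2 = (1 + s * c) ^ 2 / (1 - s ^ 2 * (c ^ 2 - 1)) := by
    rw [tangentialCurv, div_pow, hσ2]
  have hab : radialCurv c s s' * tangentialCurv c s =
      (1 - s ^ 2 * (c ^ 2 - 1) + s * c + s' * (c ^ 2 - 1)) * (1 + s * c) /
        (1 - s ^ 2 * (c ^ 2 - 1)) ^ 2 := by
    have h4 : √(1 - s ^ 2 * (c ^ 2 - 1)) ^ 3 * √(1 - s ^ 2 * (c ^ 2 - 1)) =
        (1 - s ^ 2 * (c ^ 2 - 1)) ^ 2 := by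
      rw [← pow_succ, show 3 + 1 = 2 * 2 from rfl, pow_mul, hσ2]
    rw [radialCurv, tangentialCurv, div_mul_div_comm, h4]
  rw [hb, hab]
  have e : (m - 2) * ((1 + s * c) ^ 2 / (1 - s ^ 2 * (c ^ 2 - 1))) +
      2 * ((1 - s ^ 2 * (c ^ 2 - 1) + s * c + s' * (c ^ 2 - 1)) * (1 + s * c) /
        (1 - s ^ 2 * (c ^ 2 - 1)) ^ 2) =
      (1 + s * c) * ((m - 2) * (1 + s * c) * (1 - s ^ 2 * (c ^ 2 - 1)) +
        2 * (1 - s ^ 2 * (c ^ 2 - 1) + (s * c + s' * (c ^ 2 - 1)))) /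
      (1 - s ^ 2 * (c ^ 2 - 1)) ^ 2 := by
    generalize 1 - s ^ 2 * (c ^ 2 - 1) = w at *
    field_simp
    ring
  rw [e, div_eq_iff (by positivity)]

/-- The polynomial equation is linear in `s'`; solved for it, it is the slope equation. -/
theorem polynomial_iff_slopeRhs {m c s s' h : ℝ} (hb : 0 < 1 + s * c) :
    (1 + s * c) * ((m - 2) * (1 + s * c) * (1 - s ^ 2 * (c ^ 2 - 1)) +
        2 * (1 - s ^ 2 * (c ^ 2 - 1) + (s * c + s' * (c ^ 2 - 1)))) =
      m * h ^ 2 * (1 - s ^ 2 * (c ^ 2 - 1)) ^ 2 ↔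
    s' * (c ^ 2 - 1) = SlopeODE.slopeRhs m h c s := by
  have e : (1 + s * c) * ((m - 2) * (1 + s * c) * (1 - s ^ 2 * (c ^ 2 - 1)) +
        2 * (1 - s ^ 2 * (c ^ 2 - 1) + (s * c + s' * (c ^ 2 - 1)))) -
      m * h ^ 2 * (1 - s ^ 2 * (c ^ 2 - 1)) ^ 2 =
      2 * (1 + s * c) * (s' * (c ^ 2 - 1) - SlopeODE.slopeRhs m h c s) := by
    have hb' := hb.ne'
    rw [SlopeODE.slopeRhs]
    field_simp
    ring
  rw [← sub_eq_zero, e, ← sub_eq_zero (a := s' * (c ^ 2 - 1))]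
  constructor
  · intro h0
    exact (mul_eq_zero.1 h0).resolve_left (by positivity)
  · intro h0
    rw [h0, mul_zero]

/-- In the cone `σ₁ > 0`, `σ₂ > 0` the curvature of multiplicity `n - 1` is positive. -/
theorem pos_of_sigma_pos {m a b : ℝ} (hm : 2 ≤ m) (h1 : 0 < a + (m - 1) * b)
    (h2 : 0 < (m - 2) * b ^ 2 + 2 * (a * b)) : 0 < b := by
  by_contra! hb
  have h3 : 0 < b * ((m - 2) * b + 2 * a) := by linarith [h2]
  have h4 : (m - 2) * b + 2 * a < 0 := by
    by_contra! h
    nlinarith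
  nlinarith

end RadialGraph

namespace RadialGraph

/-! ### Existence -/

open Filter Topology Set HolderGerm SlopeODE

variable {n : ℕ} {o : hyperboloid n} {h : ℝ → ℝ}

theorem ckHolderAt_comp_arcosh {α : ℝ≥0} (hα0 : 0 < α) (hα1 : α < 1)
    (hreg : HolderClassOn 2 α h (Ici 0)) {c : ℝ} (hc : 1 < c) :
    CkHolderAt 2 α (fun c => h (Real.arcosh c)) c := by
  have h1 : CkHolderAt 2 (α : ℝ) h (Real.arcosh c) :=
    ckHolderAt_of_holderClassOn hreg (Ici_mem_nhds (Real.arcosh_pos hc))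
  exact CkHolderAt.comp (by exact_mod_cast hα0) (by exact_mod_cast hα1.le)
    (Real.contDiffAt_arcosh hc) 2 h1
    (.of_contDiffAt (by exact_mod_cast hα1.le) (Real.contDiffAt_arcosh hc))

theorem eventually_comp_arcosh_eq (hconst : ∃ ε > 0, ∀ r, 0 ≤ r → r < ε → h r = h 0) :
    ∀ᶠ c in 𝓝[>] (1 : ℝ), h (Real.arcosh c) = h (Real.arcosh 1) := by
  obtain ⟨ε, hε, hh⟩ := hconst
  filter_upwards [Ioo_mem_nhdsGT (Real.one_lt_cosh.2 hε.ne')] with c hc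
  rw [Real.arcosh_zero, hh _ (Real.arcosh_nonneg hc.1.le)]
  rw [← Real.arcosh_cosh hε.le]
  exact (Real.arcosh_lt_arcosh (by linarith [hc.1]) (by positivity)).2 hc.2

theorem height_self : height o o.1.1 = 1 := by
  rw [height, lift_fst, o.2.1, neg_neg]

theorem exists_radial_solution (hn : 2 ≤ n) {α : ℝ≥0} (hα0 : 0 < α) (hα1 : α < 1)
    (o : hyperboloid n) (hpos : ∀ r, 0 ≤ r → 0 < h r) (hreg : HolderClassOn 2 α h (Ici 0))
    (hconst : ∃ ε > 0, ∀ r, 0 ≤ r → r < ε → h r = h 0) (φ₀ : ℝ) :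
    ∃ φ : hyperboloid n → ℝ, HolderClass 4 α φ ∧ IsRadial o φ ∧ IsAdmissible 2 φ ∧
      (∀ x, radialOp 2 φ x = h (hypDist o x)) ∧ φ o = φ₀ := by
  have hα0' : (0 : ℝ) < α := by exact_mod_cast hα0
  have hα1' : (α : ℝ) ≤ 1 := by exact_mod_cast hα1.le
  have hn' : (2 : ℝ) ≤ n := by exact_mod_cast hn
  have hgpos : ∀ c, 1 ≤ c → 0 < h (Real.arcosh c) := fun c hc => hpos _ (Real.arcosh_nonneg hc)
  obtain ⟨P, p, hP1, hP, hP4, hp1, hpd, hsol⟩ := exists_profile hα0' hα1' hn'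
    (g := fun c => h (Real.arcosh c)) (fun c hc => ckHolderAt_comp_arcosh hα0 hα1 hreg hc) hgpos
    (eventually_comp_arcosh_eq hconst) φ₀
  let φ : hyperboloid n → ℝ := fun x => P (-lorentz o.1 x.1)
  have hφ : ∀ y, φ (lift y) = P (height o y) := fun y => rfl
  have hw : ∀ c, 1 ≤ c → 0 < 1 - p c ^ 2 * (c ^ 2 - 1) := by
    intro c hc
    rcases hc.eq_or_lt with rfl | hc
    · norm_num
    · exact (hsol (c + 1)).spacelike c ⟨hc, lt_add_one c⟩
  have hb : ∀ c, 1 ≤ c → 0 < 1 + p c * c := by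
    intro c hc
    rcases hc.eq_or_lt with rfl | hc
    · rw [hp1]
      simpa using hgpos 1 le_rfl
    · exact (hsol (c + 1)).pos c ⟨hc, lt_add_one c⟩
  have hpder : ∀ c, 1 ≤ c → HasDerivAt p (deriv p c) c ∧
      deriv p c * (c ^ 2 - 1) = slopeRhs (n : ℝ) (h (Real.arcosh c)) c (p c) := by
    intro c hc
    rcases hc.eq_or_lt with rfl | hc
    · refine ⟨hpd.hasDerivAt, ?_⟩
      rw [hp1, slopeRhs_one_self _ (hgpos 1 le_rfl).ne']
      ring
    · have h1 := (hsol (c + 1)).hasDerivAt c ⟨hc, lt_add_one c⟩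
      refine ⟨h1.differentiableAt.hasDerivAt, ?_⟩
      rw [h1.deriv, div_mul_cancel₀ _ (sq_sub_one_pos hc).ne']
  have hcurv : ∀ c, 1 ≤ c → (n - 2) * tangentialCurv c (p c) ^ 2 +
      2 * (radialCurv c (p c) (deriv p c) * tangentialCurv c (p c)) =
        n * h (Real.arcosh c) ^ 2 := fun c hc =>
    (curvature_eq_iff_polynomial (hw c hc)).2 ((polynomial_iff_slopeRhs (hb c hc)).2 (hpder c hc).2)
  refine ⟨φ, ?_, ⟨fun r => P (Real.cosh r), fun x => ?_⟩, ⟨?_, fun y i hi => ?_⟩, fun x => ?_, ?_⟩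
  · refine holderClassOn_univ_of_ckHolderAt hα0 fun y => ?_
    exact CkHolderAt.comp hα0' hα1' (contDiff_height o).contDiffAt 4 (hP4 _ (one_le_height o y))
      (.of_contDiffAt hα1' (contDiff_height o).contDiffAt)
  · have h1 := one_le_height o x.1.1
    rw [height, lift_fst] at h1
    change P _ = P (Real.cosh (Real.arcosh _))
    rw [Real.cosh_arcosh h1]
  · exact isSpacelike_graphParam hφ (fun c hc => (hP c hc).self_of_nhds) hw
  · have hc := one_le_height o y
    have hbpos : 0 < tangentialCurv (height o y) (p (height o y)) :=
      div_pos (hb _ hc) (Real.sqrt_pos.2 (hw _ hc))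
    have hV : 0 < (n - 2) * tangentialCurv (height o y) (p (height o y)) ^ 2 +
        2 * (radialCurv (height o y) (p (height o y)) (deriv p (height o y)) *
          tangentialCurv (height o y) (p (height o y))) := by
      rw [hcurv _ hc]
      have := hgpos _ hc
      positivity
    have he := Real.exp_pos (P (height o y))
    obtain ⟨hi1, hi2⟩ := Finset.mem_Icc.1 hi
    interval_cases i
    · rw [meanCurvature_one_graphParam (by omega) hφ (hP _ hc) (hpder _ hc).1 (hw _ hc)]
      refine mul_pos (by positivity) ?_
      generalize tangentialCurv (height o y) (p (height o y)) = b at *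
      generalize radialCurv (height o y) (p (height o y)) (deriv p (height o y)) = a at *
      have h1 : 0 < b * ((n - 2) * b + 2 * a) := by linarith
      have h2 := pos_of_mul_pos_right h1 hbpos.le
      nlinarith
    · rw [meanCurvature_two_graphParam (by omega) hφ (hP _ hc) (hpder _ hc).1 (hw _ hc)]
      exact mul_pos (by positivity) (mul_pos (by linarith) hV)
  · have hc := one_le_height o x.1.1
    have h1 := (radialOp_two_eq_iff hn hφ (hP _ hc) (hpder _ hc).1 (hw _ hc)
      (hgpos _ hc)).2 (hcurv _ hc)
    rw [← hypDist_lift, lift_fst] at h1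
    exact h1
  · have h1 := height_self (o := o)
    rw [height, lift_fst] at h1
    simp only [φ, h1, hP1]

/-! ### Uniqueness -/

/-- A geodesic of the hyperboloid issuing from `o`, read in the global chart. -/
theorem exists_geodesic (hn : 1 ≤ n) (o : hyperboloid n) :
    ∃ Y : ℝ → EuclideanSpace ℝ (Fin n), (∀ {m : WithTop ℕ∞}, ContDiff ℝ m Y) ∧
      ∀ r, height o (Y r) = Real.cosh r := by
  have hne : Nontrivial (EuclideanSpace ℝ (Fin n)) :=
    Module.nontrivial_of_finrank_pos (R := ℝ) (by rw [finrank_euclideanSpace_fin]; omega)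
  obtain ⟨v, hv⟩ := exists_ne (0 : EuclideanSpace ℝ (Fin n))
  have hl : (lift o.1.1 : Minkowski n) = o.1 := by rw [lift_fst]
  have h1 := lorentz_liftDeriv_self_pos o.1.1 hv
  set ℓ := lorentz (liftDeriv o.1.1 v) (liftDeriv o.1.1 v)
  have hℓ := Real.sqrt_pos.2 h1
  set e : Minkowski n := (√ℓ)⁻¹ • liftDeriv o.1.1 v with he
  have hee : lorentz e e = 1 := by
    rw [he, lorentz_smul_left, lorentz_smul_right]
    change (√ℓ)⁻¹ * ((√ℓ)⁻¹ * ℓ) = 1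
    have := Real.sq_sqrt h1.le
    field_simp
    exact this.symm
  have hoe : lorentz o.1 e = 0 := by
    have h2 := lorentz_lift_liftDeriv o.1.1 v
    rw [hl] at h2
    rw [he, lorentz_smul_right, h2, mul_zero]
  let γ : ℝ → Minkowski n := fun r => Real.cosh r • o.1 + Real.sinh r • e
  have hγo : ∀ r, lorentz (γ r) o.1 = -Real.cosh r := by
    intro r
    simp only [γ, lorentz_add_left, lorentz_smul_left, lorentz_comm e o.1, hoe, o.2.1]
    ring
  have hγ1 : ∀ r, lorentz (γ r) (γ r) = -1 := by
    intro r
    simp only [γ, lorentz_add_left, lorentz_add_right, lorentz_smul_left, lorentz_smul_right,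
      lorentz_comm e o.1, hoe, hee, o.2.1]
    have := Real.cosh_sq r
    linarith
  have hγ : ∀ r, γ r ∈ hyperboloid n := fun r =>
    ⟨hγ1 r, pos_snd_of_lorentz_lift_neg (y := o.1.1) (hγ1 r) (by
      rw [hl, hγo, neg_lt_zero]
      exact Real.cosh_pos r)⟩
  refine ⟨fun r => (γ r).1, fun {m} => ?_, fun r => ?_⟩
  · have : (fun r => (γ r).1) = fun r => Real.cosh r • o.1.1 + Real.sinh r • e.1 := by
      funext r; simp [γ]
    rw [this]
    exact (Real.contDiff_cosh.smul contDiff_const).add (Real.contDiff_sinh.smul contDiff_const)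
  · have h2 := lift_fst (⟨γ r, hγ r⟩ : hyperboloid n)
    rw [height, h2, lorentz_comm, hγo, neg_neg]

/-- The slope `dφ/dc = f'(r) / sinh r` of a radial function `φ = f(r)` has a limit at the pole. -/
theorem tendsto_deriv_div_sinh {f : ℝ → ℝ} (hf : ContDiff ℝ 4 f) (h0 : deriv f 0 = 0) :
    Tendsto (fun r => deriv f r / Real.sinh r) (𝓝[>] 0) (𝓝 (deriv (deriv f) 0)) := by
  have h1 : Differentiable ℝ (deriv f) :=
    ((contDiff_succ_iff_deriv (n := 3)).1 (by norm_num; exact hf)).2.2.differentiable (by simp)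
  have h2 := (h1 0).hasDerivAt.tendsto_slope_zero_right
  have h3 := (Real.hasDerivAt_sinh 0).tendsto_slope_zero_right
  simp only [zero_add, h0, sub_zero, Real.sinh_zero, Real.cosh_zero, smul_eq_mul] at h2 h3
  have h4 := h2.div h3 one_ne_zero
  rw [div_one] at h4
  refine h4.congr' ?_
  filter_upwards [self_mem_nhdsWithin] with r hr
  have hr0 : r ≠ 0 := ne_of_gt hr
  simp only [Pi.div_apply]
  rw [mul_div_mul_left _ _ (inv_ne_zero hr0)]

/-- The slope of a radial solution solves the slope equation. The limit at the pole comes from the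
evenness of `r ↦ φ` along a geodesic. -/
theorem exists_profile_of_solution (hn : 2 ≤ n) {α : ℝ≥0} (hpos : ∀ r, 0 ≤ r → 0 < h r)
    (hconst : ∃ ε > 0, ∀ r, 0 ≤ r → r < ε → h r = h 0) {φ : hyperboloid n → ℝ}
    (hφ4 : HolderClass 4 α φ) (hrad : IsRadial o φ) (hadm : IsAdmissible 2 φ)
    (heq : ∀ x, radialOp 2 φ x = h (hypDist o x)) :
    ∃ P p : ℝ → ℝ, (∀ y, φ (lift y) = P (height o y)) ∧ ContinuousOn P (Ici 1) ∧
      (∀ c, 1 < c → HasDerivAt P (p c) c) ∧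
      ∀ T, IsSol n (fun c => h (Real.arcosh c)) p T := by
  have hn' : (2 : ℝ) ≤ n := by exact_mod_cast hn
  obtain ⟨Y, hY, hYh⟩ := exists_geodesic (by omega : 1 ≤ n) o
  obtain ⟨f₀, hf₀⟩ := hrad
  -- `f` is `φ` along the geodesic, as a function of the signed arc length.
  let f : ℝ → ℝ := fun r => φ (lift (Y r))
  have hf4 : ContDiff ℝ 4 f := by
    have h1 : ContDiff ℝ 4 fun y : EuclideanSpace ℝ (Fin n) => φ (lift y) := by
      have := hφ4.1
      rw [contDiffOn_univ] at this
      exact_mod_cast this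
    exact h1.comp hY
  have hf : ∀ r, f r = f₀ (Real.arcosh (Real.cosh r)) := fun r => by
    simp only [f, hf₀, hypDist_lift, hYh]
  have hf3 : ContDiff ℝ 3 (deriv f) :=
    ((contDiff_succ_iff_deriv (n := 3)).1 (by norm_num; exact hf4)).2.2
  have hfd : Differentiable ℝ f := hf4.differentiable (by simp)
  have hfd' : Differentiable ℝ (deriv f) := hf3.differentiable (by simp)
  have hfc'' : Continuous (deriv (deriv f)) := hf3.continuous_deriv (by norm_num)
  have hf0 : deriv f 0 = 0 := by
    have h1 : (fun r => f (-r)) = f := by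
      funext r
      rw [hf, hf, Real.cosh_neg]
    have h2 := deriv_comp_neg f 0
    rw [h1, neg_zero] at h2
    linarith
  let P : ℝ → ℝ := fun c => f (Real.arcosh c)
  let p : ℝ → ℝ := fun c => deriv f (Real.arcosh c) * (√(c ^ 2 - 1))⁻¹
  have hPφ : ∀ y, φ (lift y) = P (height o y) := by
    intro y
    have hc := one_le_height o y
    simp only [P]
    rw [hf, Real.arcosh_cosh (Real.arcosh_nonneg hc), hf₀, hypDist_lift]
  have hPd : ∀ c, 1 < c → HasDerivAt P (p c) c := fun c hc =>
    (hfd _).hasDerivAt.comp c (Real.hasDerivAt_arcosh hc)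
  have hpd : ∀ c, 1 < c → ∃ s', HasDerivAt p s' c ∧
      p c * c + s' * (c ^ 2 - 1) = deriv (deriv f) (Real.arcosh c) := by
    intro c hc
    have hs := sq_sub_one_pos hc
    have hσ := Real.sqrt_pos.2 hs
    have hσ2 := Real.sq_sqrt hs.le
    have h1 : HasDerivAt (fun c : ℝ => c ^ 2 - 1) (2 * c) c := by
      simpa using (hasDerivAt_pow 2 c).sub_const 1
    have h2 := ((hfd' _).hasDerivAt.comp c (Real.hasDerivAt_arcosh hc)).mul
      ((h1.sqrt hs.ne').inv hσ.ne')
    refine ⟨_, h2, ?_⟩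
    simp only [p, Function.comp_apply, Pi.inv_apply]
    generalize √(c ^ 2 - 1) = σ at *
    field_simp
    linear_combination
      (c * deriv f (Real.arcosh c) - σ * deriv (deriv f) (Real.arcosh c)) * hσ2
  have hev : ∀ {c : ℝ}, 1 < c → ∀ᶠ t in 𝓝 c, HasDerivAt P (p t) t := fun hc => by
    filter_upwards [Ioi_mem_nhds hc] with t ht using hPd t ht
  have hexY : ∀ c, 1 < c → ∃ y, height o y = c := fun c hc =>
    ⟨Y (Real.arcosh c), by rw [hYh, Real.cosh_arcosh hc.le]⟩
  have hw : ∀ c, 1 < c → 0 < 1 - p c ^ 2 * (c ^ 2 - 1) := by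
    intro c hc
    obtain ⟨y, hy⟩ := hexY c hc
    have hs := sq_sub_one_pos hc
    have hz : heightGrad o y ≠ 0 := by
      intro hz
      have := heightDeriv_heightGrad o y
      rw [hz, map_zero, hy] at this
      linarith
    have h1 := hadm.1.2 y _ hz
    rw [(hasFDerivAt_graphParam hPφ (by rw [hy]; exact hPd c hc)).fderiv, lorentz_graphDeriv_self,
      lorentz_heightGrad_left, heightDeriv_heightGrad, hy] at h1
    have h2 := pos_of_mul_pos_right h1 (sq_nonneg _)
    by_contra! hcon
    nlinarith
  have hpoly : ∀ c, 1 < c → ∃ s', HasDerivAt p s' c ∧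
      p c * c + s' * (c ^ 2 - 1) = deriv (deriv f) (Real.arcosh c) ∧ 0 < 1 + p c * c ∧
      (1 + p c * c) * ((n - 2) * (1 + p c * c) * (1 - p c ^ 2 * (c ^ 2 - 1)) +
        2 * (1 - p c ^ 2 * (c ^ 2 - 1) + (p c * c + s' * (c ^ 2 - 1)))) =
      n * h (Real.arcosh c) ^ 2 * (1 - p c ^ 2 * (c ^ 2 - 1)) ^ 2 := by
    intro c hc
    obtain ⟨y, rfl⟩ := hexY c hc
    obtain ⟨s', hs', hs''⟩ := hpd _ hc
    have hwc := hw _ hc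
    have hσ := Real.sqrt_pos.2 hwc
    have he := inv_pos.2 (Real.exp_pos (P (height o y)))
    have hm1 := hadm.2 y 1 (by simp)
    have hm2 := hadm.2 y 2 (by simp)
    rw [meanCurvature_one_graphParam (by omega) hPφ (hev hc) hs' hwc] at hm1
    rw [meanCurvature_two_graphParam (by omega) hPφ (hev hc) hs' hwc] at hm2
    have hb := pos_of_sigma_pos hn' (pos_of_mul_pos_right hm1 he.le)
      (pos_of_mul_pos_right (pos_of_mul_pos_right hm2 (by positivity)) (by linarith))
    have hb' : 0 < 1 + p (height o y) * height o y := by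
      have := mul_pos hb hσ
      rwa [tangentialCurv, div_mul_cancel₀ _ hσ.ne'] at this
    have hV := (radialOp_two_eq_iff hn hPφ (hev hc) hs' hwc
      (hpos _ (Real.arcosh_nonneg hc.le))).1 (by rw [heq, hypDist_lift])
    exact ⟨s', hs', hs'', hb', (curvature_eq_iff_polynomial hwc).1 hV⟩
  have harc : Tendsto Real.arcosh (𝓝[>] 1) (𝓝[>] 0) := by
    refine tendsto_nhdsWithin_iff.2 ⟨?_, ?_⟩
    · have h1 := (Real.continuousOn_arcosh 1 (by simp)).tendsto
      rw [Real.arcosh_zero] at h1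
      exact h1.mono_left (nhdsWithin_mono _ Ioi_subset_Ici_self)
    · filter_upwards [self_mem_nhdsWithin] with c hc using Real.arcosh_pos hc
  set l := deriv (deriv f) 0 with hl
  have hpl : Tendsto p (𝓝[>] 1) (𝓝 l) := by
    refine ((tendsto_deriv_div_sinh hf4 hf0).comp harc).congr' ?_
    filter_upwards [self_mem_nhdsWithin] with c hc
    have hc1 : (1 : ℝ) < c := hc
    simp only [Function.comp_apply, p, Real.sinh_arcosh hc1.le, div_eq_mul_inv]
  have hid : Tendsto (fun c : ℝ => c) (𝓝[>] 1) (𝓝 1) := tendsto_id.mono_left nhdsWithin_le_nhds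
  have hbl : Tendsto (fun c => 1 + p c * c) (𝓝[>] 1) (𝓝 (1 + l)) := by
    simpa using (hpl.mul hid).const_add 1
  have hwl : Tendsto (fun c => 1 - p c ^ 2 * (c ^ 2 - 1)) (𝓝[>] 1) (𝓝 1) := by
    simpa using ((hpl.pow 2).mul ((hid.pow 2).sub_const 1)).const_sub 1
  have hkl : Tendsto (fun c => deriv (deriv f) (Real.arcosh c)) (𝓝[>] 1) (𝓝 l) :=
    (hfc''.tendsto 0).comp (harc.mono_right nhdsWithin_le_nhds)
  -- At the pole the curvature equation becomes `(1 + l)² = h(0)²`.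
  have hl2 : (1 + l) * ((n - 2) * (1 + l) * 1 + 2 * (1 + l)) =
      n * h (Real.arcosh 1) ^ 2 * 1 ^ 2 := by
    have h1 := hbl.mul (((hbl.const_mul ((n : ℝ) - 2)).mul hwl).add
      ((hwl.add hkl).const_mul 2))
    have h2 := (hwl.pow 2).const_mul (n * h (Real.arcosh 1) ^ 2)
    refine tendsto_nhds_unique_of_eventuallyEq h1 h2 ?_
    filter_upwards [self_mem_nhdsWithin, eventually_comp_arcosh_eq hconst] with c hc hc'
    obtain ⟨s', -, h3, -, h4⟩ := hpoly c hc
    rw [h3, hc'] at h4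
    exact h4
  have hl0 : 0 ≤ 1 + l := by
    refine ge_of_tendsto hbl ?_
    filter_upwards [self_mem_nhdsWithin] with c hc
    obtain ⟨s', -, -, h3, -⟩ := hpoly c hc
    exact h3.le
  have hleq : l = h (Real.arcosh 1) - 1 := by
    have h1 : (n : ℝ) * ((1 + l) ^ 2 - h (Real.arcosh 1) ^ 2) = 0 := by linarith
    have h2 : (1 + l) ^ 2 = h (Real.arcosh 1) ^ 2 :=
      sub_eq_zero.1 ((mul_eq_zero.1 h1).resolve_left (by linarith))
    have h3 := (pow_left_inj₀ hl0 (hpos _ (Real.arcosh_nonneg le_rfl)).le two_ne_zero).1 h2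
    linarith
  refine ⟨P, p, hPφ, hfd.continuous.comp_continuousOn Real.continuousOn_arcosh, hPd, fun T =>
    ⟨fun c hc => hw c hc.1, fun c hc => ?_, fun c hc => ?_, ?_⟩⟩
  · obtain ⟨s', -, -, h3, -⟩ := hpoly c hc.1
    exact h3
  · obtain ⟨s', h1, -, h3, h4⟩ := hpoly c hc.1
    rw [← (polynomial_iff_slopeRhs h3).1 h4, mul_div_cancel_right₀ _ (sq_sub_one_pos hc.1).ne']
    exact h1
  · simpa only [hleq] using hpl

theorem radial_solution_unique (hn : 2 ≤ n) {α : ℝ≥0} (hα0 : 0 < α) (hα1 : α < 1)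
    (hpos : ∀ r, 0 ≤ r → 0 < h r) (hreg : HolderClassOn 2 α h (Ici 0))
    (hconst : ∃ ε > 0, ∀ r, 0 ≤ r → r < ε → h r = h 0) {φ ψ : hyperboloid n → ℝ}
    (hφ : HolderClass 4 α φ ∧ IsRadial o φ ∧ IsAdmissible 2 φ ∧
      (∀ x, radialOp 2 φ x = h (hypDist o x)))
    (hψ : HolderClass 4 α ψ ∧ IsRadial o ψ ∧ IsAdmissible 2 ψ ∧
      (∀ x, radialOp 2 ψ x = h (hypDist o x)))
    (ho : φ o = ψ o) : φ = ψ := by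
  obtain ⟨P, p, hP, hPc, hPd, hp⟩ :=
    exists_profile_of_solution hn hpos hconst hφ.1 hφ.2.1 hφ.2.2.1 hφ.2.2.2
  obtain ⟨Q, q, hQ, hQc, hQd, hq⟩ :=
    exists_profile_of_solution hn hpos hconst hψ.1 hψ.2.1 hψ.2.2.1 hψ.2.2.2
  have hpq : ∀ c, 1 < c → p c = q c := fun c hc =>
    IsSol.eqOn (by exact_mod_cast (by omega : 0 < n))
      (fun t ht => (ckHolderAt_comp_arcosh hα0 hα1 hreg ht).1.continuousAt.continuousWithinAt)
      (hpos _ (Real.arcosh_nonneg le_rfl)) (eventually_comp_arcosh_eq hconst)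
      (hp (c + 1)) (hq (c + 1)) ⟨hc, lt_add_one c⟩
  have h1 : P 1 = Q 1 := by
    have a := hP o.1.1
    have b := hQ o.1.1
    rw [lift_fst, height_self] at a b
    rw [← a, ← b, ho]
  have hPQ : ∀ c, 1 ≤ c → P c = Q c := by
    intro c hc
    have hd : ∀ t ∈ interior (Ici (1 : ℝ)), HasDerivAt (P - Q) 0 t := fun t ht => by
      rw [interior_Ici] at ht
      have := (hPd t ht).sub (hQd t ht)
      rwa [hpq t ht, sub_self] at this
    have h2 := antitoneOn_of_deriv_nonpos (convex_Ici 1) (hPc.sub hQc)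
      (fun t ht => (hd t ht).differentiableAt.differentiableWithinAt)
      (fun t ht => (hd t ht).deriv.le)
    have h3 := monotoneOn_of_deriv_nonneg (convex_Ici 1) (hPc.sub hQc)
      (fun t ht => (hd t ht).differentiableAt.differentiableWithinAt)
      (fun t ht => (hd t ht).deriv.ge)
    have := le_antisymm (h2 self_mem_Ici hc hc) (h3 self_mem_Ici hc hc)
    simp only [Pi.sub_apply, h1, sub_self] at this
    linarith
  funext x
  have a := hP x.1.1
  have b := hQ x.1.1
  rw [lift_fst] at a b
  rw [a, b, hPQ _ (one_le_height o x.1.1)]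

end RadialGraph

end

theorem mainTheorem6 (n : ℕ) (hn : 2 ≤ n) (α : NNReal) (hα0 : 0 < α) (hα1 : α < 1)
    (o : RadialGraph.hyperboloid n)
    (h : ℝ → ℝ) (hpos : ∀ r, 0 ≤ r → 0 < h r)
    (hreg : RadialGraph.HolderClassOn 2 α h (Set.Ici 0))
    (hconst : ∃ ε > 0, ∀ r, 0 ≤ r → r < ε → h r = h 0)
    (φ₀ : ℝ) :
    ∃! φ : RadialGraph.hyperboloid n → ℝ,
      RadialGraph.HolderClass 4 α φ ∧
      RadialGraph.IsRadial o φ ∧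
      RadialGraph.IsAdmissible 2 φ ∧
      (∀ x, RadialGraph.radialOp 2 φ x = h (RadialGraph.hypDist o x)) ∧
      φ o = φ₀ := by
  obtain ⟨φ, h1, h2, h3, h4, h5⟩ :=
    RadialGraph.exists_radial_solution hn hα0 hα1 o hpos hreg hconst φ₀
  refine ⟨φ, ⟨h1, h2, h3, h4, h5⟩, fun ψ hψ => ?_⟩
  exact RadialGraph.radial_solution_unique hn hα0 hα1 hpos hreg hconst
    ⟨hψ.1, hψ.2.1, hψ.2.2.1, hψ.2.2.2.1⟩ ⟨h1, h2, h3, h4⟩ (hψ.2.2.2.2.trans h5.symm)
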